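/- Let $\zeta=\frac{1+\sqrt3\,i}{2}=e^{\pi i/3}$, $e(x)=e^{2\pi i x}$, and let $C_\zeta$ be the non-singular model of the projective curve with affine equation $u^6=t^3(t-1)$. It is obtained from the plane curve by replacing its two singular points: $(t,u)=(0,0)$ by three points, distinguished by the value of $u^2/t$ (a root of $v^3=-1$), and the point at infinity by two points, distinguished by the value $\pm1$ of $\frac{u^3}{t(t-1)}$. Let $P_1=(1,0)\in C_\zeta$, let $E_\zeta=\mathbb C/(\mathbb Z\zeta+\mathbb Z)$, and let $$\jmath_\zeta:C_\zeta\to E_\zeta,\qquad P\mapsto\int_{P_1}^{P}\psi_1,\qquad \psi_1=\frac{1}{(1-\zeta^2)B(\frac13,\frac16)}\cdot\frac{u\,dt}{t(t-1)},$$ be the Abel–Jacobi map, where $B$ is the beta function. For $a,b\in\mathbb Q$ put $$\vartheta_{a,b}(z)=\vartheta_{a,b}(z,\zeta)=\sum_{n\in\mathbb Z}\exp\bigl(\pi i(n+a)^2\zeta+2\pi i(n+a)(z+b)\bigr).$$ **Theorem.** The map $\jmath_\zeta$ is well defined (the integral exists for some path from $P_1$ to $P$, and modulo $\mathbb Z\zeta+\mathbb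 Z$ it does not depend on the path) and bijective. Its inverse is given by $$t=\frac{-3\sqrt3\,i\;\vartheta_{0,0}(z)^2\,\vartheta_{0,\frac12}(z)^2\,\vartheta_{\frac12,0}(z)^2}{\bigl(\sqrt3\,i\,\vartheta_{0,0}(z)^2-\vartheta_{\frac12,\frac12}(z)^2\bigr)^3},\qquad u=e\bigl(-\tfrac18\bigr)\sqrt[4]{27}\;\frac{\vartheta_{0,0}(z)\,\vartheta_{0,\frac12}(z)\,\vartheta_{\frac12,0}(z)\,\vartheta_{\frac12,\frac12}(z)}{\bigl(\sqrt3\,i\,\vartheta_{0,0}(z)^2-\vartheta_{\frac12,\frac12}(z)^2\bigr)^2}.$$ That is, if $z\in\mathbb C$ and $P\in C_\zeta$ satisfy $\jmath_\zeta(P)=z \bmod \mathbb Z\zeta+\mathbb Z$, then $t(P)$ and $u(P)$ are the values in $\mathbb P^1(\mathbb C)$ of these two quotients at $z$ (numerator and denominator of neither quotient vanish simultaneously), and the point of $C_\zeta$ with coordinates given by the quotients at $w$ tends to $P$ in $C_\zeta$ as $w\to z$, $w\neq z$. -/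

import Mathlib

open Complex Filter Topology

noncomputable section

/-- `ζ = (1 + √3 i) / 2 = exp (π i / 3)`. -/
def zeta6 : ℂ := (1 + (Real.sqrt 3 : ℂ) * I) / 2

/-- `e(x) = exp (2 π i x)`. -/
def ex (x : ℂ) : ℂ := Complex.exp (2 * (Real.pi : ℂ) * I * x)

/-- The theta function with characteristics `a, b`:
`ϑ_{a,b}(z, τ) = ∑_{n ∈ ℤ} exp (π i (n + a)² τ + 2 π i (n + a) (z + b))`. -/
def thetaChar (a b : ℚ) (z τ : ℂ) : ℂ :=
  ∑' n : ℤ, Complex.exp ((Real.pi : ℂ) * I * ((n : ℂ) + (a : ℂ)) ^ 2 * τ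
    + 2 * (Real.pi : ℂ) * I * ((n : ℂ) + (a : ℂ)) * (z + (b : ℂ)))

/-- The lattice `L_ζ = ℤ ζ + ℤ`. -/
def latticeZeta : AddSubgroup ℂ := AddSubgroup.closure {zeta6, 1}

/-- The complex torus `E_ζ = ℂ / L_ζ`. -/
abbrev EZeta : Type := ℂ ⧸ latticeZeta

/-- The non-singular model of the projective curve `s₂⁶ = s₀² s₁³ (s₁ - s₀)`, in affine
coordinates `(t, u) = (s₁ / s₀, s₂ / s₀)` the curve `u⁶ = t³ (t - 1)`.

The only singular points of the plane curve are `(t, u) = (0, 0)` and the point at infinity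
`[0 : 1 : 0]`. The non-singular model consists of the remaining points, of three points above
`(0, 0)`, and of two points above `[0 : 1 : 0]`. The function `v = u² / t` satisfies `v³ = t - 1`,
and takes the three roots of `v³ = -1` as values at the three points above `(0, 0)`. The function
`y = u³ / (t (t - 1))` satisfies `y² = t / (t - 1)`, and takes the values `1` and `-1` at the two
points above `[0 : 1 : 0]`. -/
inductive CZeta : Type
  | finite (t u : ℂ) (ht : t ≠ 0) (h : u ^ 6 = t ^ 3 * (t - 1)) : CZeta
  | zero (v : ℂ) (h : v ^ 3 = -1) : CZeta
  | infinity (y : ℂ) (h : y ^ 2 = 1) : CZeta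

namespace CZeta

/-- The base point `P₁ = (1, 0)`. -/
def P₁ : CZeta := finite 1 0 one_ne_zero (by norm_num)

/-- The coordinate `t` as a function from `C_ζ` to the projective line. -/
def coordT : CZeta → OnePoint ℂ
  | finite t _ _ _ => (t : OnePoint ℂ)
  | zero _ _ => ((0 : ℂ) : OnePoint ℂ)
  | infinity _ _ => OnePoint.infty

/-- The coordinate `u` as a function from `C_ζ` to the projective line. -/
def coordU : CZeta → OnePoint ℂ
  | finite _ u _ _ => (u : OnePoint ℂ)
  | zero _ _ => ((0 : ℂ) : OnePoint ℂ)
  | infinity _ _ => OnePoint.infty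

/-- `Approaches l T U P`: the points of `C_ζ` with affine coordinates `(T, U)` tend to the point
`P` of the non-singular model along the filter `l`. -/
def Approaches {α : Type} (l : Filter α) (T U : α → ℂ) : CZeta → Prop
  | finite t u _ _ => Tendsto T l (𝓝 t) ∧ Tendsto U l (𝓝 u)
  | zero v _ => Tendsto T l (𝓝 0) ∧ Tendsto (fun s => U s ^ 2 / T s) l (𝓝 v)
  | infinity y _ => Tendsto T l (Bornology.cobounded ℂ) ∧
      Tendsto (fun s => U s ^ 3 / (T s * (T s - 1))) l (𝓝 y)

/-- `IsArc P Q T U`: the functions `T, U` are the coordinates of a `C¹` arc `(0, 1) → C_ζ` which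
does not meet the ramification points of `t`, and which runs from `P` to `Q`. The end points `P`
and `Q` are arbitrary points of `C_ζ`. -/
structure IsArc (P Q : CZeta) (T U : ℝ → ℂ) : Prop where
  contDiffOn_t : ContDiffOn ℝ 1 T (Set.Ioo 0 1)
  contDiffOn_u : ContDiffOn ℝ 1 U (Set.Ioo 0 1)
  curve : ∀ s ∈ Set.Ioo (0 : ℝ) 1, U s ^ 6 = T s ^ 3 * (T s - 1)
  t_ne_zero : ∀ s ∈ Set.Ioo (0 : ℝ) 1, T s ≠ 0
  t_ne_one : ∀ s ∈ Set.Ioo (0 : ℝ) 1, T s ≠ 1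
  source : Approaches (𝓝[>] (0 : ℝ)) T U P
  target : Approaches (𝓝[<] (1 : ℝ)) T U Q

/-- `HasIntegral P Q w`: the number `w` is the integral of the holomorphic `1`-form
`ψ = u dt / (t (t - 1))` along some path from `P` to `Q`. Here a path is a finite concatenation
of arcs, and the integral along an arc is the limit of the integrals along the parameter intervals
`[a, b]` for `a → 0` and `b → 1`. -/
inductive HasIntegral : CZeta → CZeta → ℂ → Prop
  | refl (P : CZeta) : HasIntegral P P 0
  | arc {P Q R : CZeta} {w w' : ℂ} {T U : ℝ → ℂ} (hPQ : HasIntegral P Q w) (hQR : IsArc Q R T U)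
      (hw' : Tendsto (fun p : ℝ × ℝ => ∫ s in p.1..p.2, U s * deriv T s / (T s * (T s - 1)))
        (𝓝[>] (0 : ℝ) ×ˢ 𝓝[<] (1 : ℝ)) (𝓝 w')) :
      HasIntegral P R (w + w')

/-- The normalizing constant `(1 - ζ²) B(1/3, 1/6)`, so that `ψ₁ = ψ / ((1 - ζ²) B(1/3, 1/6))`. -/
def period : ℂ := (1 - zeta6 ^ 2) * Complex.betaIntegral (1 / 3) (1 / 6)

open Classical in
/-- The Abel-Jacobi map `C_ζ → E_ζ`, which sends `P` to the class of `∫_{P₁}^P ψ₁` for a path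
from `P₁` to `P`. -/
def abelJacobi (P : CZeta) : EZeta :=
  if h : ∃ w : ℂ, HasIntegral P₁ P w then ((h.choose / period : ℂ) : EZeta) else 0

end CZeta

/-- The quotient `a / b` as a point of the projective line (used with `(a, b) ≠ (0, 0)`). -/
def projQuot (a b : ℂ) : OnePoint ℂ :=
  open Classical in if b = 0 then OnePoint.infty else ((a / b : ℂ) : OnePoint ℂ)

/-- `√3 i ϑ_{0,0}(z, ζ)² - ϑ_{1/2,1/2}(z, ζ)²` -/
def thetaDen (z : ℂ) : ℂ :=
  (Real.sqrt 3 : ℂ) * I * thetaChar 0 0 z zeta6 ^ 2 - thetaChar (1 / 2) (1 / 2) z zeta6 ^ 2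

/-- `-3 √3 i ϑ_{0,0}(z, ζ)² ϑ_{0,1/2}(z, ζ)² ϑ_{1/2,0}(z, ζ)²` -/
def thetaNumT (z : ℂ) : ℂ :=
  -3 * (Real.sqrt 3 : ℂ) * I * thetaChar 0 0 z zeta6 ^ 2 * thetaChar 0 (1 / 2) z zeta6 ^ 2
    * thetaChar (1 / 2) 0 z zeta6 ^ 2

/-- `e(-1/8) 27^{1/4} ϑ_{0,0}(z, ζ) ϑ_{0,1/2}(z, ζ) ϑ_{1/2,0}(z, ζ) ϑ_{1/2,1/2}(z, ζ)` -/
def thetaNumU (z : ℂ) : ℂ :=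
  ex (-1 / 8) * (((27 : ℝ) ^ (1 / 4 : ℝ) : ℝ) : ℂ) * thetaChar 0 0 z zeta6
    * thetaChar 0 (1 / 2) z zeta6 * thetaChar (1 / 2) 0 z zeta6
    * thetaChar (1 / 2) (1 / 2) z zeta6

end

noncomputable section

/-! Write S = ϑ_{1/2,1/2}, D = `thetaDen`, N = `thetaN`. The functions x = D/S² and y = N/S³ are
periodic under the lattice and satisfy y² = x³ + 1 (`thetaN_sq`). The curve C_ζ is birational to
this elliptic curve by x = t/u², y = t²/u³; the inverse t = y²/x³, u = y/x² gives exactly the two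
theta quotients. The resulting correspondence between ℂ modulo the lattice and C_ζ is the relation
`Param`. It reaches every point because x takes every value, by Liouville's theorem
(`exists_thetaDen_eq`). It separates classes because, by the addition formula, x determines z up to
sign, and y, being odd, fixes the sign (`sub_mem_of_eq`).

The correspondence inverts integration because ψ pulls back to κ dz: the Wronskian of ϑ_{0,0} and
ϑ_{1/2,1/2} is a multiple of ϑ_{0,1/2} ϑ_{1/2,0}, which amounts to x' = -(κ/3) y. An arc on C_ζ and
the theta quotients along z + κ⁻¹∫ψ then solve the same differential equation (`exists_lift`), so
the integral along a path determines its end point (`HasIntegral.param`). Conversely, segments in ℂ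
give paths with the expected integral (`hasIntegral_of_param`).

It remains to identify κ with `period`. The theta constants give only its argument, -π/6. For the
modulus, the arc t = 1/(1-s) has integral B(1/3, 1/6), and lifts, up to a lattice translation, to a
segment from 0 in the direction 1 + ζ which ends at a point at infinity. The automorphism u ↦ ζu
corresponds to multiplication by ζ; since (1+ζ)/3 is fixed by ζ² modulo the lattice, it lies over
infinity, and the segment must end there. Hence κ(1+ζ)/3 = B(1/3, 1/6), while (1-ζ²)(1+ζ) = 3.

The theta identities rest on one principle, `exists_eq_mul_theta00_theta11`: a relation of degree
two needs checking only at 0 and (1+ζ)/2. The zeros of the theta functions come from the series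
itself, whose nome has absolute value below 1/7. -/

/-- The theta function `ϑ_{0,0}(z, ζ)` in terms of the Jacobi theta function of Mathlib. -/
def thetaZeta (z : ℂ) : ℂ := jacobiTheta₂ z zeta6

/-- The zero `(1 + ζ) / 2` of `ϑ_{0,0}`. -/
def thetaZero : ℂ := (1 + zeta6) / 2

/-- `exp (- π √3 / 2)`, the absolute value of the nome. -/
def nomeAbs : ℝ := Real.exp (-(Real.pi * Real.sqrt 3 / 2))

/-! ### The number ζ and the nome -/

lemma zeta6_re : zeta6.re = 1 / 2 := by simp [zeta6]

lemma zeta6_im : zeta6.im = Real.sqrt 3 / 2 := by simp [zeta6]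

lemma zeta6_im_pos : 0 < zeta6.im := by rw [zeta6_im]; positivity

lemma sqrt_three_sq : (Real.sqrt 3 : ℂ) ^ 2 = 3 := by
  norm_cast; simp

lemma zeta6_sq : zeta6 ^ 2 = zeta6 - 1 := by
  unfold zeta6
  linear_combination (-1 / 4 : ℂ) * sqrt_three_sq + (Real.sqrt 3 : ℂ) ^ 2 / 4 * I_sq

lemma zeta6_ne_zero : zeta6 ≠ 0 := fun h => by
  have := zeta6_sq; rw [h] at this; norm_num at this

lemma zeta6_eq_exp : zeta6 = cexp (Real.pi * I / 3) := by
  have : (Real.pi : ℂ) * I / 3 = ((Real.pi / 3 : ℝ) : ℂ) * I := by push_cast; ring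
  rw [this, exp_mul_I, ← ofReal_cos, ← ofReal_sin, Real.cos_pi_div_three, Real.sin_pi_div_three,
    zeta6]
  push_cast; ring

lemma nomeAbs_pos : 0 < nomeAbs := Real.exp_pos _

lemma nomeAbs_lt : nomeAbs < 1 / 7 := by
  have h3 : (1.7 : ℝ) < Real.sqrt 3 := Real.lt_sqrt_of_sq_lt (by norm_num)
  have h2 : (2 : ℝ) < Real.pi * Real.sqrt 3 / 2 := by nlinarith [Real.pi_gt_three]
  have h1 : nomeAbs < Real.exp (-2) := Real.exp_lt_exp.mpr (by linarith)
  have h4 : (7 : ℝ) < Real.exp 2 := by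
    have := Real.exp_one_gt_d9
    have h5 : Real.exp 2 = Real.exp 1 * Real.exp 1 := by rw [← Real.exp_add]; norm_num
    rw [h5]; nlinarith
  rw [Real.exp_neg] at h1
  calc nomeAbs < (Real.exp 2)⁻¹ := h1
    _ < 1 / 7 := by rw [one_div]; exact inv_strictAnti₀ (by norm_num) h4

lemma exp_pi_I_zeta6 : cexp (Real.pi * I * zeta6) = I * nomeAbs := by
  have : (Real.pi : ℂ) * I * zeta6 = (Real.pi / 2 : ℂ) * I + ((-(Real.pi * Real.sqrt 3 / 2) : ℝ) : ℂ) := by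
    unfold zeta6; push_cast; linear_combination (Real.pi * Real.sqrt 3 / 2 : ℂ) * I_sq
  rw [this, Complex.exp_add, exp_pi_div_two_mul_I, ← ofReal_exp, nomeAbs]

/-! ### The series of ϑ_{0,0} around its zero -/

lemma thetaZeta_add_one (z : ℂ) : thetaZeta (z + 1) = thetaZeta z := jacobiTheta₂_add_left _ _

lemma thetaZeta_add_zeta (z : ℂ) :
    thetaZeta (z + zeta6) = cexp (-Real.pi * I * (zeta6 + 2 * z)) * thetaZeta z :=
  jacobiTheta₂_add_left' _ _

lemma thetaZeta_neg (z : ℂ) : thetaZeta (-z) = thetaZeta z := jacobiTheta₂_neg_left _ _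

lemma differentiable_thetaZeta : Differentiable ℂ thetaZeta :=
  fun z => differentiableAt_jacobiTheta₂_fst z zeta6_im_pos

/-- The terms of the series of `ϑ_{0,0}` at `z + (1 + ζ) / 2`. -/
lemma jacobiTheta₂_term_thetaZero (n : ℤ) (z : ℂ) :
    jacobiTheta₂_term n (z + thetaZero) zeta6 =
      (-1) ^ n * cexp (Real.pi * I * zeta6 * (n * (n + 1))) * cexp (2 * Real.pi * I * z) ^ n := by
  rw [jacobiTheta₂_term, ← exp_pi_mul_I, ← Complex.exp_int_mul, ← Complex.exp_int_mul,
    ← Complex.exp_add, ← Complex.exp_add, thetaZero]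
  congr 1; ring

/-- The nome raised to the power `n (n + 1)` is real. -/
lemma exp_zeta6_mul_succ (n : ℕ) :
    cexp (Real.pi * I * zeta6 * (n * (n + 1))) = (((-1) ^ (n * (n + 1) / 2) * nomeAbs ^ (n * (n + 1)) : ℝ) : ℂ) := by
  have h : (Real.pi * I * zeta6 * (n * (n + 1)) : ℂ) = ((n * (n + 1) : ℕ) : ℂ) * (Real.pi * I * zeta6) := by
    push_cast; ring
  obtain ⟨k, hk⟩ := even_iff_two_dvd.mp (Nat.even_mul_succ_self n)
  rw [h, Complex.exp_nat_mul, exp_pi_I_zeta6, mul_pow]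
  have : n * (n + 1) / 2 = k := by omega
  rw [this, hk, pow_mul I, I_sq]
  push_cast; ring

/-- The exponent n(n+1) of the nome is invariant under n ↦ -n-1 while the sign (-1)^n changes, so at
z = 0 the terms cancel in pairs. -/
lemma jacobiTheta₂_term_pair (n : ℕ) (z : ℂ) :
    jacobiTheta₂_term n (z + thetaZero) zeta6 + jacobiTheta₂_term (-((n : ℤ) + 1)) (z + thetaZero) zeta6 =
      (((-1) ^ n * (-1) ^ (n * (n + 1) / 2) * nomeAbs ^ (n * (n + 1)) : ℝ) : ℂ) *
      (cexp (2 * Real.pi * I * z) ^ (n : ℤ) - cexp (2 * Real.pi * I * z) ^ (-((n : ℤ) + 1))) := by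
  have e1 : ((-((n : ℤ) + 1) : ℤ) : ℂ) * (((-((n : ℤ) + 1) : ℤ) : ℂ) + 1) = n * (n + 1) := by
    push_cast; ring
  have e2 : ((-1 : ℂ)) ^ (-((n : ℤ) + 1)) = - (-1) ^ n := by
    rw [zpow_neg, zpow_add_one₀ (by norm_num), zpow_natCast, mul_inv, ← inv_pow]; norm_num
  rw [jacobiTheta₂_term_thetaZero, jacobiTheta₂_term_thetaZero, e1, e2]
  have := exp_zeta6_mul_succ n
  push_cast at this ⊢
  rw [this, zpow_natCast]
  ring

lemma hasSum_thetaZeta (z : ℂ) :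
    HasSum (fun n : ℕ => (((-1) ^ n * (-1) ^ (n * (n + 1) / 2) * nomeAbs ^ (n * (n + 1)) : ℝ) : ℂ) *
      (cexp (2 * Real.pi * I * z) ^ (n : ℤ) - cexp (2 * Real.pi * I * z) ^ (-((n : ℤ) + 1))))
      (thetaZeta (z + thetaZero)) := by
  have h := (hasSum_jacobiTheta₂_term (z + thetaZero) zeta6_im_pos).nat_add_neg_add_one
  simp_rw [jacobiTheta₂_term_pair] at h
  exact h

/-- Extracts from each pair of terms the factor 1 - w⁻¹ that carries the zero; the cofactor has 2n+1
terms, with exponents between -n and n. -/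
lemma zpow_sub_zpow_neg (w : ℂ) (hw : w ≠ 0) (n : ℕ) :
    w ^ (n : ℤ) - w ^ (-((n : ℤ) + 1)) =
      (1 - w⁻¹) * ∑ k ∈ Finset.range (2 * n + 1), w ^ ((k : ℤ) - n) := by
  induction n with
  | zero => simp
  | succ n ih =>
    have h1 : ∑ k ∈ Finset.range (2 * (n + 1) + 1), w ^ ((k : ℤ) - (n + 1 : ℕ)) =
        w ^ (-((n : ℤ) + 1)) + ∑ k ∈ Finset.range (2 * n + 1), w ^ ((k : ℤ) - n) + w ^ ((n : ℤ) + 1) := by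
      rw [show 2 * (n + 1) + 1 = (2 * n + 1 + 1) + 1 by ring, Finset.sum_range_succ,
        Finset.sum_range_succ']
      rw [add_comm (∑ k ∈ Finset.range (2 * n + 1), w ^ (((k + 1 : ℕ) : ℤ) - (n + 1 : ℕ)))]
      congr 1
      · congr 1
        · refine Finset.sum_congr rfl fun k _ => ?_
          congr 1; push_cast; ring
      · congr 1; push_cast; ring
    rw [h1, mul_add, mul_add, ← ih]
    push_cast
    rw [show -((n : ℤ) + 1 + 1) = -((n : ℤ) + 1) - 1 by ring, zpow_sub_one₀ hw,
      zpow_add_one₀ hw]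
    field_simp
    ring

/-- A series whose first term dominates. -/
lemma norm_sub_one_le_of_hasSum {g : ℕ → ℂ} {a : ℂ} (hg : HasSum g a) (h0 : g 0 = 1)
    (hb : ∀ n, 1 ≤ n → ‖g n‖ ≤ (2 * n + 1) * (1 / 7 : ℝ) ^ n) : ‖a - 1‖ ≤ 5 / 9 := by
  have h1 : HasSum (fun n : ℕ => g (n + 1)) (a - 1) := by
    have := (hasSum_nat_add_iff' 1).mpr hg
    simpa [h0] using this
  -- The sum of (2n+1)/7ⁿ over n ≥ 0 is 14/9; without its first term it is 5/9 < 1.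
  have h2 : HasSum (fun n : ℕ => (2 * (n : ℝ) + 1) * (1 / 7 : ℝ) ^ n) (14 / 9) := by
    have e1 := (hasSum_coe_mul_geometric_of_norm_lt_one (r := (1 / 7 : ℝ)) (by norm_num)).mul_left 2
    have e2 := hasSum_geometric_of_norm_lt_one (ξ := (1 / 7 : ℝ)) (by norm_num)
    have := e1.add e2
    have e3 : (14 / 9 : ℝ) = 2 * (1 / 7 / (1 - 1 / 7) ^ 2) + (1 - 1 / 7)⁻¹ := by norm_num
    rw [e3]
    refine this.congr_fun fun n => ?_
    ring
  have h3 := (hasSum_nat_add_iff' 1).mpr h2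
  have h4 := h1.norm_le_of_bounded h3 (fun n => by
    have := hb (n + 1) (by omega)
    exact this)
  refine h4.trans ?_
  norm_num

lemma nomeAbs_pow_le (n : ℕ) : nomeAbs ^ n ≤ (1 / 7 : ℝ) ^ n :=
  pow_le_pow_left₀ nomeAbs_pos.le nomeAbs_lt.le n

lemma nomeAbs_lt_one : nomeAbs < 1 := nomeAbs_lt.trans (by norm_num)

/-- In the strip `|Im z| ≤ √3 / 4` the zeros of `ϑ_{0,0}(z + (1 + ζ) / 2)` are integers. -/
lemma exp_eq_one_of_thetaZeta_eq_zero {z : ℂ} (h1 : |z.im| ≤ Real.sqrt 3 / 4)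
    (h : thetaZeta (z + thetaZero) = 0) : cexp (2 * Real.pi * I * z) = 1 := by
  set w := cexp (2 * Real.pi * I * z) with hw
  have hw0 : w ≠ 0 := Complex.exp_ne_zero _
  have hwn : ‖w‖ = Real.exp (-(2 * Real.pi * z.im)) := by
    rw [hw, Complex.norm_exp]; congr 1; simp
  obtain ⟨hl, hu⟩ := abs_le.mp h1
  have hpi := Real.pi_pos
  have hw1 : nomeAbs ≤ ‖w‖ := by
    rw [hwn, nomeAbs]; apply Real.exp_le_exp.mpr; nlinarith
  have hw2 : ‖w‖ ≤ nomeAbs⁻¹ := by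
    rw [hwn, nomeAbs, ← Real.exp_neg]; apply Real.exp_le_exp.mpr; nlinarith
  by_contra hne
  have hne' : (1 - w⁻¹) ≠ 0 := by
    intro h'; apply hne
    have : w⁻¹ = 1 := (sub_eq_zero.mp h').symm
    simpa using this
  -- With q = `nomeAbs` and q ≤ |w| ≤ q⁻¹, division by 1 - w⁻¹ leaves a series with first term 1 and
  -- n-th term at most (2n+1)q^(n²). Its sum 0 would then lie within 5/9 of 1.
  have hs := (hasSum_thetaZeta z).mul_left (1 - w⁻¹)⁻¹
  rw [h, mul_zero] at hs
  have := norm_sub_one_le_of_hasSum hs (by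
    rw [← hw, zpow_sub_zpow_neg w hw0]; simp [hne']) (fun n hn => by
    rw [← hw, zpow_sub_zpow_neg w hw0, mul_left_comm, inv_mul_cancel_left₀ hne', norm_mul]
    have e1 : ‖(((-1) ^ n * (-1) ^ (n * (n + 1) / 2) * nomeAbs ^ (n * (n + 1)) : ℝ) : ℂ)‖ = nomeAbs ^ (n * (n + 1)) := by
      rw [norm_real]; simp [abs_of_pos nomeAbs_pos]
    have e2 : ‖∑ k ∈ Finset.range (2 * n + 1), w ^ ((k : ℤ) - n)‖ ≤ (2 * n + 1) * (nomeAbs⁻¹) ^ n := by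
      refine (norm_sum_le_of_le _ (f := fun k : ℕ => w ^ ((k : ℤ) - n)) (n := fun _ => (nomeAbs⁻¹) ^ n) ?_).trans ?_
      · intro k hk
        have hk' : k < 2 * n + 1 := Finset.mem_range.mp hk
        rw [norm_zpow]
        rcases le_total n k with hnk | hnk
        · obtain ⟨j, rfl⟩ := Nat.exists_eq_add_of_le hnk
          rw [show ((n + j : ℕ) : ℤ) - n = (j : ℤ) by push_cast; ring, zpow_natCast]
          refine (pow_le_pow_left₀ (norm_nonneg _) hw2 j).trans ?_
          exact pow_le_pow_right₀ (one_le_inv_iff₀.mpr ⟨nomeAbs_pos, nomeAbs_lt_one.le⟩) (by omega)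
        · obtain ⟨j, rfl⟩ := Nat.exists_eq_add_of_le hnk
          rw [show (k : ℤ) - (k + j : ℕ) = -(j : ℤ) by push_cast; ring, zpow_neg, zpow_natCast,
            ← inv_pow]
          refine (pow_le_pow_left₀ (by positivity) (inv_anti₀ nomeAbs_pos hw1) j).trans ?_
          exact pow_le_pow_right₀ (one_le_inv_iff₀.mpr ⟨nomeAbs_pos, nomeAbs_lt_one.le⟩) (by omega)
      · simp
    rw [e1]
    calc nomeAbs ^ (n * (n + 1)) * ‖∑ k ∈ Finset.range (2 * n + 1), w ^ ((k : ℤ) - n)‖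
        ≤ nomeAbs ^ (n * (n + 1)) * ((2 * n + 1) * (nomeAbs⁻¹) ^ n) := by
          exact mul_le_mul_of_nonneg_left e2 (pow_pos nomeAbs_pos _).le
      _ = (2 * n + 1) * nomeAbs ^ (n * n) := by
          rw [mul_add, pow_add, inv_pow, mul_one]
          have := pow_ne_zero n nomeAbs_pos.ne'
          field_simp
      _ ≤ (2 * n + 1) * nomeAbs ^ n := by
          gcongr ?_ * ?_
          exact pow_le_pow_of_le_one nomeAbs_pos.le nomeAbs_lt_one.le (by nlinarith)
      _ ≤ _ := by gcongr; exact nomeAbs_pos.le; exact nomeAbs_lt.le)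
  norm_num at this

/-- The derivative of `ϑ_{0,0}` at its zero is `2 π i ρ` with `ρ > 0`. -/
lemma exists_hasDerivAt_thetaZeta :
    ∃ ρ : ℝ, 0 < ρ ∧ HasDerivAt thetaZeta (2 * Real.pi * I * ρ) thetaZero := by
  have h := (hasSum_jacobiTheta₂'_term (0 + thetaZero) zeta6_im_pos).nat_add_neg_add_one
  have h1 : ∀ n : ℕ, jacobiTheta₂'_term n (0 + thetaZero) zeta6 +
      jacobiTheta₂'_term (-((n : ℤ) + 1)) (0 + thetaZero) zeta6 = 2 * Real.pi * I *
      (((-1) ^ n * (-1) ^ (n * (n + 1) / 2) * nomeAbs ^ (n * (n + 1)) * (2 * n + 1) : ℝ) : ℂ) := by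
    intro n
    have e := jacobiTheta₂_term_pair n 0
    -- Paired terms are opposite at the zero, so their derivatives add up with the weight n - (-n-1)
    -- = 2n+1.
    have e0 : jacobiTheta₂_term (-((n : ℤ) + 1)) (0 + thetaZero) zeta6 = - jacobiTheta₂_term n (0 + thetaZero) zeta6 := by
      rw [eq_neg_iff_add_eq_zero, add_comm, e]; simp
    have e2 := exp_zeta6_mul_succ n
    have e3 := jacobiTheta₂_term_thetaZero n 0
    simp only [jacobiTheta₂'_term]
    rw [e0, e3]
    push_cast at e2 ⊢
    rw [e2]; simp; ring
  simp_rw [h1] at h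
  have hpi : (2 * Real.pi * I : ℂ) ≠ 0 := by simp [Real.pi_ne_zero]
  have h2 := h.mul_left (2 * Real.pi * I : ℂ)⁻¹
  simp_rw [inv_mul_cancel_left₀ hpi] at h2
  set a := (2 * Real.pi * I : ℂ)⁻¹ * jacobiTheta₂' (0 + thetaZero) zeta6 with ha
  have h3 : ‖a - 1‖ ≤ 5 / 9 := by
    refine norm_sub_one_le_of_hasSum h2 (by simp) (fun n hn => ?_)
    rw [norm_real]
    simp only [norm_mul, norm_pow, norm_neg, norm_one, one_pow, one_mul]
    rw [Real.norm_of_nonneg nomeAbs_pos.le, Real.norm_of_nonneg (by positivity), mul_comm]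
    gcongr
    exact (pow_le_pow_of_le_one nomeAbs_pos.le nomeAbs_lt_one.le (by nlinarith)).trans (nomeAbs_pow_le n)
  have h4 : ((a.re : ℝ) : ℂ) = a := by
    have h5 := Complex.hasSum_re h2
    simp only [ofReal_re] at h5
    exact (Complex.hasSum_ofReal.mpr h5).unique h2
  refine ⟨a.re, ?_, ?_⟩
  · have := (abs_re_le_norm (a - 1)).trans h3
    rw [sub_re, one_re, abs_le] at this
    linarith [this.1]
  · rw [h4, ha, mul_inv_cancel_left₀ hpi, zero_add]
    exact hasDerivAt_jacobiTheta₂_fst thetaZero zeta6_im_pos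

/-- `ϑ_{0,0}(0)` has positive real part. -/
lemma thetaZeta_zero_re_pos : 0 < (thetaZeta 0).re := by
  have h := (hasSum_jacobiTheta₂_term 0 zeta6_im_pos).nat_add_neg
  -- Summing over pairs (n, -n) counts the term of index 0, which is 1, twice.
  have h0 : HasSum (fun n : ℕ => if n = 0 then (1 : ℂ) else 0) 1 := by
    simpa using hasSum_ite_eq (0 : ℕ) (1 : ℂ)
  have h1 := h.sub h0
  have e0 : jacobiTheta₂_term 0 0 zeta6 = 1 := by simp [jacobiTheta₂_term]
  have h3 : ‖thetaZeta 0 - 1‖ ≤ 5 / 9 := by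
    refine norm_sub_one_le_of_hasSum (g := _) (a := thetaZeta 0) (by simpa [e0, thetaZeta, jacobiTheta₂] using h1) (by simp [e0]) ?_
    intro n hn
    have hn' : n ≠ 0 := by omega
    simp only [hn', if_false, sub_zero]
    have e1 : ∀ m : ℤ, m ^ 2 = n ^ 2 → ‖jacobiTheta₂_term m 0 zeta6‖ = nomeAbs ^ (n ^ 2) := by
      intro m hm
      rw [norm_jacobiTheta₂_term, nomeAbs, ← Real.exp_nat_mul, zeta6_im]
      have : (m : ℝ) ^ 2 = (n : ℝ) ^ 2 := by exact_mod_cast hm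
      congr 1; rw [this]; push_cast; simp; ring
    refine (norm_add_le _ _).trans ?_
    rw [e1 n rfl, e1 (-n) (by ring)]
    have e2 : nomeAbs ^ (n ^ 2) ≤ (1 / 7 : ℝ) ^ n :=
      (pow_le_pow_of_le_one nomeAbs_pos.le nomeAbs_lt_one.le (by nlinarith)).trans (nomeAbs_pow_le n)
    have e3 : (1 : ℝ) ≤ n := by exact_mod_cast hn
    nlinarith [pow_pos (show (0 : ℝ) < 1 / 7 by norm_num) n]
  have := (abs_re_le_norm (thetaZeta 0 - 1)).trans h3
  rw [sub_re, one_re, abs_le] at this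
  linarith [this.1]

/-! ### The lattice and the zeros of ϑ_{0,0} -/

lemma mem_latticeZeta {z : ℂ} : z ∈ latticeZeta ↔ ∃ m n : ℤ, z = m * zeta6 + n := by
  rw [latticeZeta, AddSubgroup.mem_closure_pair]
  simp only [zsmul_eq_mul, mul_one, eq_comm]

lemma one_mem_latticeZeta : (1 : ℂ) ∈ latticeZeta := mem_latticeZeta.mpr ⟨0, 1, by simp⟩

lemma zeta6_mem_latticeZeta : zeta6 ∈ latticeZeta := mem_latticeZeta.mpr ⟨1, 0, by simp⟩

lemma latticeZeta_induction {p : ℂ → Prop} (h1 : ∀ z, p (z + 1) ↔ p z)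
    (h2 : ∀ z, p (z + zeta6) ↔ p z) {l : ℂ} (hl : l ∈ latticeZeta) (z : ℂ) : p (z + l) ↔ p z := by
  induction hl using AddSubgroup.closure_induction generalizing z with
  | mem x hx =>
    rcases hx with rfl | hx
    · exact h2 z
    · rw [Set.mem_singleton_iff.mp hx]; exact h1 z
  | zero => simp
  | add x y _ _ hx hy => rw [← add_assoc, hy, hx]
  | neg x _ hx => rw [← hx (z + -x)]; simp

lemma thetaZeta_add_mem {l : ℂ} (hl : l ∈ latticeZeta) (z : ℂ) :
    thetaZeta (z + l) = 0 ↔ thetaZeta z = 0 :=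
  latticeZeta_induction (p := fun z => thetaZeta z = 0) (fun z => by rw [thetaZeta_add_one])
    (fun z => by rw [thetaZeta_add_zeta]; simp) hl z

lemma thetaZeta_thetaZero : thetaZeta thetaZero = 0 := by
  have h := hasSum_thetaZeta 0
  simp only [mul_zero, Complex.exp_zero, one_zpow, sub_self, zero_add] at h
  exact h.unique hasSum_zero

/-- The zeros of `ϑ_{0,0}`. -/
lemma thetaZeta_add_thetaZero_eq_zero {z : ℂ} :
    thetaZeta (z + thetaZero) = 0 ↔ z ∈ latticeZeta := by
  constructor
  · intro h
    -- Since Im ζ = √3/2, subtracting the nearest multiple of ζ brings z into the strip |Im z| ≤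
    -- √3/4.
    set k : ℤ := round (z.im / (Real.sqrt 3 / 2)) with hk
    have h3 : (0 : ℝ) < Real.sqrt 3 := by positivity
    have hl : -(k * zeta6) ∈ latticeZeta := mem_latticeZeta.mpr ⟨-k, 0, by simp⟩
    have h1 : thetaZeta ((z + -(k * zeta6)) + thetaZero) = 0 := by
      rw [add_right_comm]; exact (thetaZeta_add_mem hl _).mpr h
    have h2 : |(z + -(k * zeta6)).im| ≤ Real.sqrt 3 / 4 := by
      have := abs_sub_round (z.im / (Real.sqrt 3 / 2))
      have e : (z + -(k * zeta6)).im = (z.im / (Real.sqrt 3 / 2) - k) * (Real.sqrt 3 / 2) := by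
        simp [zeta6_im]; field_simp; ring
      rw [← hk] at this
      rw [e, abs_mul, abs_of_pos (show (0 : ℝ) < Real.sqrt 3 / 2 by positivity)]
      nlinarith
    have h4 := exp_eq_one_of_thetaZeta_eq_zero h2 h1
    obtain ⟨n, hn⟩ := Complex.exp_eq_one_iff.mp h4
    have hpi : (2 * Real.pi * I : ℂ) ≠ 0 := by simp [Real.pi_ne_zero]
    refine mem_latticeZeta.mpr ⟨k, n, ?_⟩
    have : z + -(k * zeta6) = n := mul_left_cancel₀ hpi (by rw [hn]; ring)
    linear_combination this
  · intro h
    rw [add_comm, thetaZeta_add_mem h]; exact thetaZeta_thetaZero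

/-! ### The four theta functions: translations, parity, zeros -/

/-- `ϑ_{0,0}(z, ζ)` -/
def theta00 (z : ℂ) : ℂ := thetaChar 0 0 z zeta6

/-- `ϑ_{0,1/2}(z, ζ)` -/
def theta01 (z : ℂ) : ℂ := thetaChar 0 (1 / 2) z zeta6

/-- `ϑ_{1/2,0}(z, ζ)` -/
def theta10 (z : ℂ) : ℂ := thetaChar (1 / 2) 0 z zeta6

/-- `ϑ_{1/2,1/2}(z, ζ)` -/
def theta11 (z : ℂ) : ℂ := thetaChar (1 / 2) (1 / 2) z zeta6

/-- The fourth root `exp (π i ζ / 4)` of the nome. -/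
def nomeRoot : ℂ := cexp (Real.pi * I * zeta6 / 4)

/-- `exp (π i z)` -/
def expPiI (z : ℂ) : ℂ := cexp (Real.pi * I * z)

lemma nomeRoot_ne_zero : nomeRoot ≠ 0 := Complex.exp_ne_zero _

lemma expPiI_ne_zero (z : ℂ) : expPiI z ≠ 0 := Complex.exp_ne_zero _

lemma expPiI_add (z w : ℂ) : expPiI (z + w) = expPiI z * expPiI w := by
  rw [expPiI, mul_add, Complex.exp_add]; rfl

lemma expPiI_neg (z : ℂ) : expPiI (-z) = (expPiI z)⁻¹ := by
  rw [expPiI, mul_neg, Complex.exp_neg]; rfl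

lemma expPiI_one : expPiI 1 = -1 := by rw [expPiI, mul_one, exp_pi_mul_I]

lemma expPiI_half : expPiI (1 / 2) = I := by
  have : (Real.pi : ℂ) * I * (1 / 2) = Real.pi / 2 * I := by ring
  rw [expPiI, this, exp_pi_div_two_mul_I]

lemma expPiI_zeta6 : expPiI zeta6 = nomeRoot ^ 4 := by
  rw [expPiI, nomeRoot, ← Complex.exp_nat_mul]; congr 1; push_cast; ring

lemma expPiI_half_zeta6 : expPiI (zeta6 / 2) = nomeRoot ^ 2 := by
  rw [expPiI, nomeRoot, ← Complex.exp_nat_mul]; congr 1; push_cast; ring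

lemma expPiI_zero : expPiI 0 = 1 := by simp [expPiI]

lemma expPiI_thetaZero : expPiI thetaZero = I * nomeRoot ^ 2 := by
  rw [← expPiI_half, ← expPiI_half_zeta6, ← expPiI_add, thetaZero]; congr 1; ring

lemma differentiable_expPiI : Differentiable ℂ expPiI := by
  unfold expPiI; fun_prop

lemma thetaZeta_add_zeta' (z : ℂ) :
    thetaZeta (z + zeta6) = (nomeRoot ^ 4)⁻¹ * (expPiI z ^ 2)⁻¹ * thetaZeta z := by
  rw [thetaZeta_add_zeta, ← expPiI_zeta6, expPiI, expPiI, ← Complex.exp_nat_mul, ← Complex.exp_neg,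
    ← Complex.exp_neg, ← Complex.exp_add]
  congr 2; push_cast; ring

lemma thetaChar_eq (a b : ℚ) (z τ : ℂ) : thetaChar a b z τ =
    cexp (Real.pi * I * a ^ 2 * τ + 2 * Real.pi * I * a * (z + b)) *
      jacobiTheta₂ (z + b + a * τ) τ := by
  rw [thetaChar, jacobiTheta₂, ← tsum_mul_left]
  refine tsum_congr fun n => ?_
  rw [jacobiTheta₂_term, ← Complex.exp_add]
  congr 1; ring

lemma theta00_eq (z : ℂ) : theta00 z = thetaZeta z := by
  simp [theta00, thetaChar_eq, thetaZeta]

lemma theta01_eq (z : ℂ) : theta01 z = thetaZeta (z + 1 / 2) := by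
  simp [theta01, thetaChar_eq, thetaZeta]

lemma theta10_eq (z : ℂ) : theta10 z = nomeRoot * expPiI z * thetaZeta (z + zeta6 / 2) := by
  rw [theta10, thetaChar_eq, thetaZeta, nomeRoot, expPiI, ← Complex.exp_add]
  congr 1
  · congr 1; push_cast; ring
  · congr 1; push_cast; ring

lemma theta11_eq (z : ℂ) : theta11 z = I * nomeRoot * expPiI z * thetaZeta (z + thetaZero) := by
  have h := expPiI_half
  rw [expPiI] at h
  rw [theta11, thetaChar_eq, thetaZeta, nomeRoot, expPiI]
  nth_rewrite 3 [← h]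
  rw [← Complex.exp_add, ← Complex.exp_add]
  congr 1
  · congr 1; push_cast; ring
  · congr 1; rw [thetaZero]; push_cast; ring

lemma differentiable_theta00 : Differentiable ℂ theta00 := by
  rw [show theta00 = thetaZeta from funext theta00_eq]; exact differentiable_thetaZeta

lemma differentiable_theta01 : Differentiable ℂ theta01 := by
  rw [show theta01 = _ from funext theta01_eq]
  exact differentiable_thetaZeta.comp (by fun_prop)

lemma differentiable_theta10 : Differentiable ℂ theta10 := by
  rw [show theta10 = _ from funext theta10_eq]
  exact (differentiable_expPiI.const_mul _).mul (differentiable_thetaZeta.comp (by fun_prop))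

lemma differentiable_theta11 : Differentiable ℂ theta11 := by
  rw [show theta11 = _ from funext theta11_eq]
  exact (differentiable_expPiI.const_mul _).mul (differentiable_thetaZeta.comp (by fun_prop))

/-- The multiplier of theta functions for the translation by `ζ`. -/
def thetaMult (z : ℂ) : ℂ := (nomeRoot ^ 4)⁻¹ * (expPiI z ^ 2)⁻¹

lemma thetaMult_ne_zero (z : ℂ) : thetaMult z ≠ 0 := by
  simp [thetaMult, nomeRoot_ne_zero, expPiI_ne_zero]

lemma theta00_add_one (z : ℂ) : theta00 (z + 1) = theta00 z := by
  rw [theta00_eq, theta00_eq, thetaZeta_add_one]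

lemma theta01_add_one (z : ℂ) : theta01 (z + 1) = theta01 z := by
  rw [theta01_eq, theta01_eq, add_right_comm, thetaZeta_add_one]

lemma theta10_add_one (z : ℂ) : theta10 (z + 1) = -theta10 z := by
  rw [theta10_eq, theta10_eq, add_right_comm, thetaZeta_add_one, expPiI_add, expPiI_one]; ring

lemma theta11_add_one (z : ℂ) : theta11 (z + 1) = -theta11 z := by
  rw [theta11_eq, theta11_eq, add_right_comm, thetaZeta_add_one, expPiI_add, expPiI_one]; ring

lemma theta00_add_zeta (z : ℂ) : theta00 (z + zeta6) = thetaMult z * theta00 z := by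
  rw [theta00_eq, theta00_eq, thetaZeta_add_zeta', thetaMult]

lemma theta01_add_zeta (z : ℂ) : theta01 (z + zeta6) = -thetaMult z * theta01 z := by
  rw [theta01_eq, theta01_eq, add_right_comm, thetaZeta_add_zeta', thetaMult, expPiI_add,
    expPiI_half, mul_pow, I_sq]
  simp

lemma theta10_add_zeta (z : ℂ) : theta10 (z + zeta6) = thetaMult z * theta10 z := by
  rw [theta10_eq, theta10_eq, add_right_comm, thetaZeta_add_zeta', thetaMult, expPiI_add,
    expPiI_add, expPiI_half_zeta6, expPiI_zeta6]
  have h1 := nomeRoot_ne_zero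
  have h2 := expPiI_ne_zero z
  field_simp

lemma theta11_add_zeta (z : ℂ) : theta11 (z + zeta6) = -thetaMult z * theta11 z := by
  rw [theta11_eq, theta11_eq, add_right_comm, thetaZeta_add_zeta', thetaMult, expPiI_add,
    expPiI_add, expPiI_thetaZero, expPiI_zeta6]
  have h1 := nomeRoot_ne_zero
  have h2 := expPiI_ne_zero z
  rw [mul_pow, mul_pow, I_sq]
  field_simp

/-- The multiplier of theta functions for the translation by `(1 + ζ) / 2`. -/
def halfMult (z : ℂ) : ℂ := nomeRoot⁻¹ * (expPiI z)⁻¹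

lemma halfMult_ne_zero (z : ℂ) : halfMult z ≠ 0 := by
  simp [halfMult, nomeRoot_ne_zero, expPiI_ne_zero]

/-- Translation by (1+ζ)/2 exchanges ϑ_{0,0} with ϑ_{1/2,1/2} and ϑ_{0,1/2} with ϑ_{1/2,0}, up to
factors; values at `thetaZero` thereby reduce to theta constants at 0. -/
lemma theta00_add_thetaZero (z : ℂ) : theta00 (z + thetaZero) = -I * halfMult z * theta11 z := by
  rw [theta00_eq, theta11_eq, halfMult]
  have h1 := nomeRoot_ne_zero
  have h2 := expPiI_ne_zero z
  field_simp
  simp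

lemma theta11_add_thetaZero (z : ℂ) : theta11 (z + thetaZero) = -halfMult z * theta00 z := by
  rw [theta00_eq, theta11_eq, halfMult, show z + thetaZero + thetaZero = z + 1 + zeta6 by
    rw [thetaZero]; ring, thetaZeta_add_zeta', thetaZeta_add_one, expPiI_add, expPiI_add,
    expPiI_one, expPiI_thetaZero]
  have h1 := nomeRoot_ne_zero
  have h2 := expPiI_ne_zero z
  field_simp
  simp

lemma theta01_add_thetaZero (z : ℂ) : theta01 (z + thetaZero) = halfMult z * theta10 z := by
  rw [theta01_eq, theta10_eq, halfMult, show z + thetaZero + 1 / 2 = z + zeta6 / 2 + 1 by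
    rw [thetaZero]; ring, thetaZeta_add_one]
  have h1 := nomeRoot_ne_zero
  have h2 := expPiI_ne_zero z
  field_simp

lemma theta10_add_thetaZero (z : ℂ) : theta10 (z + thetaZero) = -I * halfMult z * theta01 z := by
  rw [theta01_eq, theta10_eq, halfMult, show z + thetaZero + zeta6 / 2 = z + 1 / 2 + zeta6 by
    rw [thetaZero]; ring, thetaZeta_add_zeta', expPiI_add, expPiI_add, expPiI_half,
    expPiI_thetaZero]
  have h1 := nomeRoot_ne_zero
  have h2 := expPiI_ne_zero z
  rw [mul_pow, I_sq]
  field_simp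

lemma theta00_neg (z : ℂ) : theta00 (-z) = theta00 z := by
  rw [theta00_eq, theta00_eq, thetaZeta_neg]

lemma theta01_neg (z : ℂ) : theta01 (-z) = theta01 z := by
  rw [theta01_eq, theta01_eq, ← thetaZeta_neg, ← thetaZeta_add_one]; congr 1; ring

lemma theta10_neg (z : ℂ) : theta10 (-z) = theta10 z := by
  rw [theta10_eq, theta10_eq, show -z + zeta6 / 2 = -(z + zeta6 / 2) + zeta6 by ring,
    thetaZeta_add_zeta', thetaZeta_neg, expPiI_neg, expPiI_neg, expPiI_add, expPiI_half_zeta6]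
  have h1 := nomeRoot_ne_zero
  have h2 := expPiI_ne_zero z
  field_simp

lemma theta11_neg (z : ℂ) : theta11 (-z) = -theta11 z := by
  rw [theta11_eq, theta11_eq, show -z + thetaZero = -(z + thetaZero) + zeta6 + 1 by
    rw [thetaZero]; ring,
    thetaZeta_add_one, thetaZeta_add_zeta', thetaZeta_neg, expPiI_neg, expPiI_neg, expPiI_add,
    expPiI_thetaZero]
  have h1 := nomeRoot_ne_zero
  have h2 := expPiI_ne_zero z
  rw [inv_pow, inv_inv, mul_pow, mul_pow, I_sq]
  field_simp

lemma theta11_eq_zero {z : ℂ} : theta11 z = 0 ↔ z ∈ latticeZeta := by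
  rw [theta11_eq, ← thetaZeta_add_thetaZero_eq_zero]
  simp [nomeRoot_ne_zero, expPiI_ne_zero]

lemma theta11_zero : theta11 0 = 0 := theta11_eq_zero.mpr (zero_mem _)

lemma theta00_eq_zero {z : ℂ} : theta00 z = 0 ↔ z - thetaZero ∈ latticeZeta := by
  rw [← thetaZeta_add_thetaZero_eq_zero, theta00_eq, sub_add_cancel]

lemma theta01_eq_zero {z : ℂ} : theta01 z = 0 ↔ z - zeta6 / 2 ∈ latticeZeta := by
  rw [← thetaZeta_add_thetaZero_eq_zero, theta01_eq, thetaZero]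
  ring_nf

lemma theta10_eq_zero {z : ℂ} : theta10 z = 0 ↔ z - 1 / 2 ∈ latticeZeta := by
  rw [← thetaZeta_add_thetaZero_eq_zero, theta10_eq, thetaZero]
  simp only [mul_eq_zero, nomeRoot_ne_zero, expPiI_ne_zero, false_or]
  ring_nf

/-- The derivative of `ϑ_{1/2,1/2}` at `0` is `-2 π ρ exp (π i ζ / 4)` with `ρ > 0`. -/
lemma exists_hasDerivAt_theta11 :
    ∃ ρ : ℝ, 0 < ρ ∧ HasDerivAt theta11 (-2 * Real.pi * ρ * nomeRoot) 0 := by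
  obtain ⟨ρ, hρ, h⟩ := exists_hasDerivAt_thetaZeta
  refine ⟨ρ, hρ, ?_⟩
  have h1 : HasDerivAt (fun z => thetaZeta (z + thetaZero)) (2 * Real.pi * I * ρ) 0 := by
    apply HasDerivAt.comp_add_const
    simpa using h
  have h2 : HasDerivAt expPiI (deriv expPiI 0) 0 := (differentiable_expPiI 0).hasDerivAt
  have h3 := ((h2.const_mul (I * nomeRoot)).mul h1)
  rw [show theta11 = _ from funext theta11_eq]
  refine h3.congr_deriv ?_
  rw [zero_add, thetaZeta_thetaZero, expPiI_zero]
  linear_combination (2 * Real.pi * nomeRoot * ρ : ℂ) * I_sq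

/-! ### Theta constants -/

/-- `exp (π i / 24)` -/
def root48 : ℂ := cexp (Real.pi * I / 24)

lemma root48_pow_12 : root48 ^ 12 = I := by
  rw [root48, ← Complex.exp_nat_mul]
  refine Eq.trans ?_ expPiI_half
  rw [expPiI]; congr 1; push_cast; ring

lemma root48_pow_8 : root48 ^ 8 = zeta6 := by
  rw [root48, ← Complex.exp_nat_mul, zeta6_eq_exp]; congr 1; push_cast; ring

lemma root48_ne_zero : root48 ≠ 0 := Complex.exp_ne_zero _

lemma sqrt_three_eq : (Real.sqrt 3 : ℂ) * I = 2 * root48 ^ 8 - 1 := by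
  rw [root48_pow_8, zeta6]; ring

lemma thetaZeta_zero_ne_zero : thetaZeta 0 ≠ 0 := fun h => by
  have := thetaZeta_zero_re_pos; rw [h] at this; simp at this

/-- ζ is the fixed point of τ ↦ 1 - 1/τ; this is why the modular transformations relate the theta
constants at ζ to one another. -/
lemma neg_inv_zeta6 : -1 / zeta6 = zeta6 - 1 := by
  rw [div_eq_iff zeta6_ne_zero]; linear_combination -zeta6_sq

lemma neg_I_mul_zeta6_cpow : (-I * zeta6) ^ (1 / 2 : ℂ) = (root48 ^ 2)⁻¹ := by
  have h : -I * zeta6 = cexp (((-Real.pi / 6 : ℝ) : ℂ) * I) := by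
    rw [show -I = cexp (-(Real.pi / 2 * I)) by rw [Complex.exp_neg, exp_pi_div_two_mul_I, inv_I],
      zeta6_eq_exp, ← Complex.exp_add]
    congr 1; push_cast; ring
  have hpi := Real.pi_pos
  -- The angle -π/6 lies in the principal range, so the square root is exp(-πi/12).
  rw [cpow_def_of_ne_zero (by simp [zeta6_ne_zero]), h, Complex.log_exp (by simp; linarith)
    (by simp; linarith), root48, ← Complex.exp_nat_mul, ← Complex.exp_neg]
  congr 1; push_cast; ring

/-- Termwise, the exponents differ by -πi n(n+1), a multiple of 2πi because n(n+1) is even. -/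
lemma jacobiTheta₂_zeta6_sub_one (z : ℂ) :
    jacobiTheta₂ z (zeta6 - 1) = thetaZeta (z + 1 / 2) := by
  rw [thetaZeta, jacobiTheta₂, jacobiTheta₂]
  refine tsum_congr fun n => ?_
  rw [jacobiTheta₂_term, jacobiTheta₂_term, Complex.exp_eq_exp_iff_exists_int]
  obtain ⟨k, hk⟩ := even_iff_two_dvd.mp (Int.even_mul_succ_self n)
  refine ⟨-k, ?_⟩
  have : (n : ℂ) * (n + 1) = 2 * k := by exact_mod_cast hk
  push_cast
  linear_combination (-Real.pi * I) * this

lemma theta01_zero : theta01 0 = (root48 ^ 2)⁻¹ * theta00 0 := by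
  have h := jacobiTheta₂_functional_equation 0 zeta6
  rw [neg_I_mul_zeta6_cpow, neg_inv_zeta6, zero_div, jacobiTheta₂_zeta6_sub_one] at h
  simp only [ne_eq, OfNat.ofNat_ne_zero, not_false_eq_true, zero_pow, mul_zero, zero_div,
    Complex.exp_zero, mul_one, one_div, inv_inv] at h
  rw [theta01_eq, theta00_eq, one_div]
  change _ = _ * jacobiTheta₂ 0 zeta6
  rw [h, inv_mul_cancel_left₀]
  simp [root48_ne_zero]

/-- The functional equation is used at z = ζ/2, where its exponential factor cancels `nomeRoot`. -/
lemma theta10_zero : theta10 0 = root48 ^ 2 * theta00 0 := by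
  have h := jacobiTheta₂_functional_equation (zeta6 / 2) zeta6
  have e : zeta6 / 2 / zeta6 = 1 / 2 := by field_simp [zeta6_ne_zero]
  have e2 : -Real.pi * I * (zeta6 / 2) ^ 2 / zeta6 = -(Real.pi * I * zeta6 / 4) := by
    field_simp [zeta6_ne_zero]; ring
  rw [neg_I_mul_zeta6_cpow, neg_inv_zeta6, jacobiTheta₂_zeta6_sub_one, e, e2, Complex.exp_neg] at h
  have e3 : thetaZeta (1 / 2 + 1 / 2) = theta00 0 := by
    rw [theta00_eq, ← thetaZeta_add_one 0]; norm_num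
  rw [theta10_eq, expPiI_zero, zero_add, thetaZeta, h, e3, ← nomeRoot]
  have := nomeRoot_ne_zero
  field_simp

/-- Conjugation replaces τ by minus its conjugate, and for ζ this is ζ - 1. Together with the sign
of the real part, this fixes the argument of ϑ_{0,0}(0). -/
lemma conj_theta00_zero : (starRingEnd ℂ) (theta00 0) = (root48 ^ 2)⁻¹ * theta00 0 := by
  rw [← theta01_zero, theta00_eq, thetaZeta, jacobiTheta₂_conj, theta01_eq,
    ← jacobiTheta₂_zeta6_sub_one]
  congr 1
  · simp
  · apply Complex.ext <;> simp [zeta6_re, zeta6_im]; norm_num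

lemma theta00_zero_ne_zero : theta00 0 ≠ 0 := by rw [theta00_eq]; exact thetaZeta_zero_ne_zero

/-- The theta constant `ϑ_{0,0}(0, ζ)` has argument `π / 24`. -/
lemma exists_theta00_zero : ∃ α : ℝ, 0 < α ∧ theta00 0 = α * root48 := by
  have hc : (starRingEnd ℂ) root48 = root48⁻¹ := by
    rw [root48, ← Complex.exp_conj, ← Complex.exp_neg]
    congr 1; simp [neg_div, map_ofNat]
  have h1 : (starRingEnd ℂ) (theta00 0 / root48) = theta00 0 / root48 := by
    rw [map_div₀, conj_theta00_zero, hc]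
    have := root48_ne_zero
    field_simp
  obtain ⟨α, hα⟩ := Complex.conj_eq_iff_real.mp h1
  have h2 : theta00 0 = α * root48 := by rw [← hα, div_mul_cancel₀ _ root48_ne_zero]
  refine ⟨α, ?_, h2⟩
  have h3 := thetaZeta_zero_re_pos
  rw [← theta00_eq, h2, re_ofReal_mul] at h3
  have h4 : root48 = cexp ((Real.pi / 24 : ℝ) * I) := by
    rw [root48]; congr 1; push_cast; ring
  have h5 : 0 < root48.re := by
    rw [h4, exp_ofReal_mul_I_re]
    exact Real.cos_pos_of_mem_Ioo ⟨by linarith [Real.pi_pos], by linarith [Real.pi_pos]⟩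
  exact pos_of_mul_pos_left h3 h5.le

/-! ### Liouville's theorem and theta functions of degree two -/

/-- An entire function which vanishes on the zeros of an entire function with simple zeros is
divisible by it. -/
lemma exists_differentiable_mul_eq {f g : ℂ → ℂ} (hf : Differentiable ℂ f)
    (hg : Differentiable ℂ g) (h : ∀ z, g z = 0 → f z = 0 ∧ deriv g z ≠ 0) :
    ∃ k : ℂ → ℂ, Differentiable ℂ k ∧ ∀ z, f z = k z * g z := by
  classical
  refine ⟨fun z => if g z = 0 then deriv f z / deriv g z else f z / g z, fun z₀ => ?_, fun z => ?_⟩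
  · by_cases h0 : g z₀ = 0
    · obtain ⟨hf0, hg0⟩ := h z₀ h0
      have d1 : ∀ {u : ℂ → ℂ}, Differentiable ℂ u → Differentiable ℂ (dslope u z₀) := fun {u} hu =>
        differentiableOn_univ.mp
          ((Complex.differentiableOn_dslope Filter.univ_mem).mpr hu.differentiableOn)
      have hne : dslope g z₀ z₀ ≠ 0 := by rwa [dslope_same]
      have hev := (d1 hg).continuous.continuousAt.eventually_ne hne
      -- At a common zero, f/g is the quotient of the two difference quotients, and the denominator
      -- does not vanish there because the zero of g is simple.
      refine DifferentiableAt.congr_of_eventuallyEq (f := fun z => dslope f z₀ z / dslope g z₀ z)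
        ((d1 hf z₀).div (d1 hg z₀) hne) ?_
      filter_upwards [hev] with z hz
      by_cases hzz : z = z₀
      · subst hzz; simp [h0, dslope_same]
      · have e1 : ∀ {u : ℂ → ℂ}, u z₀ = 0 → dslope u z₀ z = (z - z₀)⁻¹ * u z := fun {u} hu => by
          rw [dslope_of_ne _ hzz, slope_def_field, hu]; ring
        rw [e1 h0] at hz
        have hgz : g z ≠ 0 := right_ne_zero_of_mul hz
        have hsub : z - z₀ ≠ 0 := sub_ne_zero.mpr hzz
        simp only [hgz, if_false]
        rw [e1 h0, e1 hf0]
        field_simp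
    · have hev := hg.continuous.continuousAt.eventually_ne h0
      refine DifferentiableAt.congr_of_eventuallyEq (f := fun z => f z / g z)
        ((hf z₀).div (hg z₀) h0) ?_
      filter_upwards [hev] with z hz
      simp [hz]
  · by_cases h0 : g z = 0
    · simp [h0, (h z h0).1]
    · simp [h0]

/-- A continuous function whose absolute value is doubly periodic is bounded. -/
lemma exists_norm_le_of_periodic {h : ℂ → ℂ} (hc : Continuous h) (h1 : ∀ z, ‖h (z + 1)‖ = ‖h z‖)
    (h2 : ∀ z, ‖h (z + zeta6)‖ = ‖h z‖) : ∃ C, ∀ z, ‖h z‖ ≤ C := by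
  have hK : IsCompact ((fun p : ℝ × ℝ => (p.1 : ℂ) + p.2 * zeta6) '' (Set.Icc 0 1 ×ˢ Set.Icc 0 1)) :=
    (isCompact_Icc.prod isCompact_Icc).image (by fun_prop)
  obtain ⟨C, hC⟩ := hK.exists_bound_of_continuousOn hc.continuousOn
  refine ⟨C, fun z => ?_⟩
  have h3 : (0 : ℝ) < Real.sqrt 3 := by positivity
  set b : ℝ := z.im / (Real.sqrt 3 / 2) with hb
  set a : ℝ := z.re - b / 2 with ha
  have hz : z = a + b * zeta6 := by
    apply Complex.ext
    · simp [zeta6_re, ha]; ring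
    · simp [zeta6_im]; rw [hb]; field_simp
  have hl : (⌊b⌋ * zeta6 + ⌊a⌋ : ℂ) ∈ latticeZeta := mem_latticeZeta.mpr ⟨_, _, rfl⟩
  have hz' : z = ((Int.fract a : ℝ) + (Int.fract b : ℝ) * zeta6) + (⌊b⌋ * zeta6 + ⌊a⌋) := by
    rw [Int.fract, Int.fract, hz]; push_cast; ring
  rw [hz']
  refine (latticeZeta_induction (p := fun z => ‖h z‖ ≤ C) (fun z => by rw [h1])
    (fun z => by rw [h2]) hl _).mpr (hC _ ⟨(Int.fract a, Int.fract b), ⟨?_, ?_⟩, rfl⟩)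
  · exact ⟨Int.fract_nonneg _, (Int.fract_lt_one _).le⟩
  · exact ⟨Int.fract_nonneg _, (Int.fract_lt_one _).le⟩

/-- Liouville's theorem for doubly periodic functions. -/
lemma exists_eq_const_of_periodic {h : ℂ → ℂ} (hc : Differentiable ℂ h)
    (h1 : ∀ z, ‖h (z + 1)‖ = ‖h z‖) (h2 : ∀ z, ‖h (z + zeta6)‖ = ‖h z‖) : ∃ c, ∀ z, h z = c := by
  obtain ⟨C, hC⟩ := exists_norm_le_of_periodic hc.continuous h1 h2
  refine ⟨h 0, fun z => hc.apply_eq_apply_of_bounded ?_ z 0⟩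
  refine (Metric.isBounded_closedBall (x := (0 : ℂ)) (r := C)).subset ?_
  rintro _ ⟨w, rfl⟩
  simpa using hC w

/-- At a zero of g the derivative of the multiplier drops out of the product rule. -/
lemma simple_zero_add_iff {g c : ℂ → ℂ} {a : ℂ} (hg : Differentiable ℂ g) (hc : Differentiable ℂ c)
    (hc0 : ∀ z, c z ≠ 0) (h : ∀ z, g (z + a) = c z * g z) (z : ℂ) :
    (g (z + a) = 0 ∧ deriv g (z + a) ≠ 0) ↔ (g z = 0 ∧ deriv g z ≠ 0) := by
  have e1 : g (z + a) = 0 ↔ g z = 0 := by rw [h]; simp [hc0]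
  have e2 : deriv g (z + a) = deriv c z * g z + c z * deriv g z := by
    rw [← deriv_comp_add_const, show (fun z => g (z + a)) = fun z => c z * g z from funext h]
    exact deriv_fun_mul (hc z) (hg z)
  rw [e1, e2]
  constructor
  · rintro ⟨h1, h3⟩; rw [h1] at h3; exact ⟨h1, fun h4 => h3 (by rw [h4]; ring)⟩
  · rintro ⟨h1, h3⟩; rw [h1]; exact ⟨rfl, by simpa using ⟨hc0 z, h3⟩⟩

lemma differentiable_thetaMult : Differentiable ℂ thetaMult := by
  unfold thetaMult
  exact ((differentiable_expPiI.pow 2).inv (by simp [expPiI_ne_zero])).const_mul _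

lemma differentiable_halfMult : Differentiable ℂ halfMult := by
  unfold halfMult
  exact (differentiable_expPiI.inv (by simp [expPiI_ne_zero])).const_mul _

lemma deriv_theta11_zero_ne_zero : deriv theta11 0 ≠ 0 := by
  obtain ⟨ρ, hρ, h⟩ := exists_hasDerivAt_theta11
  rw [h.deriv]
  simp [Real.pi_ne_zero, hρ.ne', nomeRoot_ne_zero]

lemma theta00_mul_theta11_eq_zero {z : ℂ} (h : theta00 z * theta11 z = 0) :
    z ∈ latticeZeta ∨ z - thetaZero ∈ latticeZeta := by
  rcases mul_eq_zero.mp h with h | h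
  · exact Or.inr (theta00_eq_zero.mp h)
  · exact Or.inl (theta11_eq_zero.mp h)

/-- A theta function of degree two which vanishes at the zeros of `ϑ_{0,0} ϑ_{1/2,1/2}` is a
multiple of it. -/
lemma exists_eq_mul_theta00_theta11 {f : ℂ → ℂ} {ε ε' : ℂ} (hf : Differentiable ℂ f)
    (h0 : f 0 = 0) (h0' : f thetaZero = 0) (hε : ‖ε‖ = 1) (hε' : ‖ε'‖ = 1)
    (h1 : ∀ z, f (z + 1) = ε * f z) (h2 : ∀ z, f (z + zeta6) = ε' * thetaMult z ^ 2 * f z) :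
    (∃ C, ∀ z, f z = C * (theta00 z * theta11 z)) ∧
    ((ε ≠ -1 ∨ ε' ≠ -1) → ∀ z, f z = 0) := by
  set g : ℂ → ℂ := fun z => theta00 z * theta11 z with hg
  have hgd : Differentiable ℂ g := differentiable_theta00.mul differentiable_theta11
  have g1 : ∀ z, g (z + 1) = -1 * g z := fun z => by
    simp only [hg, theta00_add_one, theta11_add_one]; ring
  have g2 : ∀ z, g (z + zeta6) = -thetaMult z ^ 2 * g z := fun z => by
    simp only [hg, theta00_add_zeta, theta11_add_zeta]; ring
  have g3 : ∀ z, g (z + thetaZero) = (I * halfMult z ^ 2) * g z := fun z => by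
    simp only [hg, theta00_add_thetaZero, theta11_add_thetaZero]; ring
  have hε0 : ε ≠ 0 := by rw [← norm_ne_zero_iff, hε]; norm_num
  have hε0' : ε' ≠ 0 := by rw [← norm_ne_zero_iff, hε']; norm_num
  have s0 : g 0 = 0 ∧ deriv g 0 ≠ 0 := by
    refine ⟨by simp [hg, theta11_zero], ?_⟩
    rw [hg, deriv_fun_mul (differentiable_theta00 0) (differentiable_theta11 0), theta11_zero]
    simp [theta00_zero_ne_zero, deriv_theta11_zero_ne_zero]
  have s1 : g thetaZero = 0 ∧ deriv g thetaZero ≠ 0 := by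
    rw [← zero_add thetaZero]
    refine (simple_zero_add_iff hgd ((differentiable_halfMult.pow 2).const_mul I) (fun z => ?_) g3 0).mpr s0
    simp [halfMult_ne_zero]
  have hs : ∀ z, ∀ l ∈ latticeZeta, (f z = 0 ∧ g z = 0 ∧ deriv g z ≠ 0) →
      (f (z + l) = 0 ∧ deriv g (z + l) ≠ 0) := by
    intro z l hl hz
    have := (latticeZeta_induction (p := fun z => f z = 0 ∧ (g z = 0 ∧ deriv g z ≠ 0))
      (fun z => by
        rw [h1, simple_zero_add_iff hgd (differentiable_const (-1 : ℂ)) (by simp) g1]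
        simp [hε0])
      (fun z => by
        rw [h2, simple_zero_add_iff hgd (differentiable_thetaMult.pow 2).neg
          (by simp [thetaMult_ne_zero]) g2]
        simp [hε0', thetaMult_ne_zero]) hl z).mpr hz
    exact ⟨this.1, this.2.2⟩
  -- All zeros of g are lattice translates of 0 and `thetaZero`; they are simple, and f vanishes
  -- there.
  obtain ⟨k, hk, hfk⟩ := exists_differentiable_mul_eq hf hgd (fun z hz => by
    rcases theta00_mul_theta11_eq_zero hz with h | h
    · simpa using hs 0 z h ⟨h0, s0⟩
    · simpa using hs thetaZero _ h ⟨h0', s1⟩)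
  -- By the identity theorem the zero set of g has dense complement, so g can be cancelled from
  -- identities between continuous functions.
  have hdense : ∀ u v : ℂ → ℂ, Continuous u → Continuous v → (∀ z, u z * g z = v z * g z) → u = v := by
    intro u v hu hv huv
    have hd : Dense {z | g z ≠ 0} := by
      intro z
      rw [mem_closure_iff_frequently]
      by_contra hcon
      rw [not_frequently] at hcon
      have h3 : g =ᶠ[𝓝 z] 0 := by
        filter_upwards [hcon] with w hw
        simpa using hw
      have h4 := (hgd.differentiableOn (s := Set.univ)).analyticOnNhd isOpen_univ
      have h5 := h4.eqOn_zero_of_preconnected_of_eventuallyEq_zero isPreconnected_univ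
        (Set.mem_univ z) h3
      have h6 : g = fun _ => 0 := funext fun w => h5 (Set.mem_univ w)
      exact s0.2 (by rw [h6]; simp)
    exact Continuous.ext_on hd hu hv fun z hz => mul_right_cancel₀ hz (huv z)
  have k1 : (fun z => k (z + 1)) = fun z => -ε * k z := hdense _ _
    (hk.continuous.comp (by fun_prop)) (by have := hk.continuous; fun_prop) fun z => by
      have := h1 z
      rw [hfk, hfk, g1] at this
      linear_combination -this
  have k2 : (fun z => k (z + zeta6)) = fun z => -ε' * k z := hdense _ _
    (hk.continuous.comp (by fun_prop)) (by have := hk.continuous; fun_prop) fun z => by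
      have := h2 z
      rw [hfk, hfk, g2] at this
      apply mul_left_cancel₀ (pow_ne_zero 2 (thetaMult_ne_zero z))
      linear_combination -this
  -- The quotient k has multipliers -ε and -ε' of modulus 1, hence is constant; a nonzero constant
  -- forces ε = ε' = -1.
  obtain ⟨C, hC⟩ := exists_eq_const_of_periodic hk
    (fun z => by rw [congrFun k1 z]; simp [hε]) (fun z => by rw [congrFun k2 z]; simp [hε'])
  refine ⟨⟨C, fun z => by rw [hfk, hC]⟩, fun hor z => ?_⟩
  have c1 := congrFun k1 0
  have c2 := congrFun k2 0
  simp only [hC] at c1 c2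
  have : C = 0 := by
    rcases hor with h | h
    · have : (1 + ε) * C = 0 := by linear_combination c1
      rcases mul_eq_zero.mp this with h' | h'
      · exact absurd (by linear_combination h') h
      · exact h'
    · have : (1 + ε') * C = 0 := by linear_combination c2
      rcases mul_eq_zero.mp this with h' | h'
      · exact absurd (by linear_combination h') h
      · exact h'
  rw [hfk, hC, this, zero_mul]

/-! ### Quadratic relations and the addition formula -/

lemma theta00_thetaZero : theta00 thetaZero = 0 := theta00_eq_zero.mpr (by simp [zero_mem])

/-- The difference of the sides has multipliers ε = ε' = 1, so its vanishing at 0 and `thetaZero`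
suffices. The theta constants dictate the coefficients. -/
lemma theta01_sq (z : ℂ) :
    theta01 z ^ 2 = (root48 ^ 4)⁻¹ * theta00 z ^ 2 + root48 ^ 4 * theta11 z ^ 2 := by
  have h := (exists_eq_mul_theta00_theta11
    (f := fun z => theta01 z ^ 2 - ((root48 ^ 4)⁻¹ * theta00 z ^ 2 + root48 ^ 4 * theta11 z ^ 2))
    (ε := 1) (ε' := 1) ?_ ?_ ?_ (by simp) (by simp) ?_ ?_).2 (by norm_num) z
  · linear_combination h
  · exact (differentiable_theta01.pow 2).sub (((differentiable_theta00.pow 2).const_mul _).add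
      ((differentiable_theta11.pow 2).const_mul _))
  · simp only [theta01_zero, theta11_zero]; ring
  · simp only [theta00_thetaZero]
    rw [← zero_add thetaZero, theta01_add_thetaZero, theta11_add_thetaZero, theta10_zero]
    ring
  · intro z
    simp only [theta00_add_one, theta01_add_one, theta11_add_one]; ring
  · intro z
    simp only [theta00_add_zeta, theta01_add_zeta, theta11_add_zeta]; ring

lemma theta10_sq (z : ℂ) :
    theta10 z ^ 2 = root48 ^ 4 * theta00 z ^ 2 - (root48 ^ 4)⁻¹ * theta11 z ^ 2 := by
  have h := (exists_eq_mul_theta00_theta11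
    (f := fun z => theta10 z ^ 2 - (root48 ^ 4 * theta00 z ^ 2 - (root48 ^ 4)⁻¹ * theta11 z ^ 2))
    (ε := 1) (ε' := 1) ?_ ?_ ?_ (by simp) (by simp) ?_ ?_).2 (by norm_num) z
  · linear_combination h
  · exact (differentiable_theta10.pow 2).sub (((differentiable_theta00.pow 2).const_mul _).sub
      ((differentiable_theta11.pow 2).const_mul _))
  · simp only [theta10_zero, theta11_zero]; ring
  · simp only [theta00_thetaZero]
    rw [← zero_add thetaZero, theta10_add_thetaZero, theta11_add_thetaZero, theta01_zero]
    simp only [mul_pow, neg_sq, I_sq]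
    ring
  · intro z
    simp only [theta00_add_one, theta10_add_one, theta11_add_one]; ring
  · intro z
    simp only [theta00_add_zeta, theta10_add_zeta, theta11_add_zeta]; ring

/-- The addition formula for `ϑ_{1/2,1/2}`. -/
lemma theta11_add_mul_theta11_sub (z b : ℂ) :
    theta00 0 ^ 2 * (theta11 (z + b) * theta11 (z - b)) =
      theta11 z ^ 2 * theta00 b ^ 2 - theta00 z ^ 2 * theta11 b ^ 2 := by
  have h := (exists_eq_mul_theta00_theta11
    (f := fun z => theta00 0 ^ 2 * (theta11 (z + b) * theta11 (z - b)) -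
      (theta11 z ^ 2 * theta00 b ^ 2 - theta00 z ^ 2 * theta11 b ^ 2))
    (ε := 1) (ε' := 1) ?_ ?_ ?_ (by simp) (by simp) ?_ ?_).2 (by norm_num) z
  · linear_combination h
  · have h1 : Differentiable ℂ fun z => theta11 (z + b) := differentiable_theta11.comp (by fun_prop)
    have h2 : Differentiable ℂ fun z => theta11 (z - b) := differentiable_theta11.comp (by fun_prop)
    exact ((h1.mul h2).const_mul _).sub (((differentiable_theta11.pow 2).mul_const _).sub
      ((differentiable_theta00.pow 2).mul_const _))
  · simp only [zero_add, zero_sub, theta11_zero, theta11_neg]; ring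
  · simp only [theta00_thetaZero]
    rw [show thetaZero - b = -b + thetaZero by ring, add_comm thetaZero b, theta11_add_thetaZero,
      theta11_add_thetaZero, theta00_neg, ← zero_add thetaZero, theta11_add_thetaZero]
    simp only [halfMult, expPiI_neg, expPiI_zero]
    have := expPiI_ne_zero b
    field_simp
    ring
  · intro z
    rw [show z + 1 + b = z + b + 1 by ring, show z + 1 - b = z - b + 1 by ring]
    simp only [theta00_add_one, theta11_add_one]; ring
  · intro z
    rw [show z + zeta6 + b = z + b + zeta6 by ring, show z + zeta6 - b = z - b + zeta6 by ring]
    simp only [theta00_add_zeta, theta11_add_zeta, thetaMult, sub_eq_add_neg, expPiI_add, expPiI_neg]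
    have := expPiI_ne_zero b
    field_simp

/-! ### The Wronskian of ϑ_{0,0} and ϑ_{1/2,1/2} -/

/-- The Wronskian of two functions. -/
def wronskian (f g : ℂ → ℂ) (z : ℂ) : ℂ := deriv f z * g z - f z * deriv g z

/-- Both translation factors are constant multiples of the same m, so the terms with m' cancel. -/
lemma wronskian_add {f₁ f₂ g₁ g₂ m : ℂ → ℂ} {a c₁ c₂ : ℂ} (hg₁ : Differentiable ℂ g₁)
    (hg₂ : Differentiable ℂ g₂) (hm : Differentiable ℂ m) (h₁ : ∀ z, f₁ (z + a) = c₁ * m z * g₁ z)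
    (h₂ : ∀ z, f₂ (z + a) = c₂ * m z * g₂ z) (z : ℂ) :
    wronskian f₁ f₂ (z + a) = c₁ * c₂ * m z ^ 2 * wronskian g₁ g₂ z := by
  have key : ∀ {f g : ℂ → ℂ} {c : ℂ}, Differentiable ℂ g → (∀ z, f (z + a) = c * m z * g z) →
      deriv f (z + a) = c * (deriv m z * g z + m z * deriv g z) := fun {f g c} hg h => by
    rw [← deriv_comp_add_const, show (fun z => f (z + a)) = fun z => c * (m z * g z) from
      funext fun z => by rw [h]; ring, deriv_const_mul_field, deriv_fun_mul (hm z) (hg z)]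
  rw [wronskian, wronskian, key hg₁ h₁, key hg₂ h₂, h₁, h₂]
  ring

lemma deriv_of_even {f : ℂ → ℂ} (h : ∀ z, f (-z) = f z) (z : ℂ) : deriv f (-z) = -deriv f z := by
  have := deriv_comp_neg f z
  simp only [h] at this
  rw [this, neg_neg]

lemma deriv_of_odd {f : ℂ → ℂ} (h : ∀ z, f (-z) = -f z) (z : ℂ) : deriv f (-z) = deriv f z := by
  have := deriv_comp_neg f z
  simp only [h] at this
  rw [deriv.fun_neg] at this
  exact (neg_injective this).symm

lemma differentiable_deriv {f : ℂ → ℂ} (h : Differentiable ℂ f) : Differentiable ℂ (deriv f) := by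
  have := h.differentiableOn (s := Set.univ)
  exact differentiableOn_univ.mp (this.deriv isOpen_univ)

/-- The derivative of `ϑ_{0,0} / ϑ_{1/2,1/2}`. -/
lemma wronskian_theta00_theta11 (z : ℂ) :
    wronskian theta00 theta11 z = -(deriv theta11 0 / theta00 0) * (theta01 z * theta10 z) := by
  have hA := theta00_zero_ne_zero
  have h00 := differentiable_theta00
  have h11 := differentiable_theta11
  set f : ℂ → ℂ := fun z => wronskian theta00 theta11 z +
    deriv theta11 0 / theta00 0 * (theta01 z * theta10 z) with hf
  have hz := fun z => wronskian_add (f₁ := theta00) (f₂ := theta11) (m := thetaMult) (c₁ := 1) (c₂ := -1)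
    h00 h11 differentiable_thetaMult (fun z => by rw [theta00_add_zeta]; ring)
    (fun z => by rw [theta11_add_zeta]; ring) z
  have h1 := fun z => wronskian_add (f₁ := theta00) (f₂ := theta11) (m := fun _ => 1) (c₁ := 1) (c₂ := -1)
    h00 h11 (differentiable_const _) (fun z => by rw [theta00_add_one]; ring)
    (fun z => by rw [theta11_add_one]; ring) z
  have hh := fun z => wronskian_add (f₁ := theta00) (f₂ := theta11) (m := halfMult) (c₁ := -I) (c₂ := -1)
    h11 h00 differentiable_halfMult (fun z => by rw [theta00_add_thetaZero])
    (fun z => by rw [theta11_add_thetaZero]; ring) z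
  -- The coefficient of ϑ_{0,1/2} ϑ_{1/2,0} is chosen to make f vanish at 0; `hsym` carries this
  -- over to `thetaZero`.
  have f0 : f 0 = 0 := by
    have h10 : theta01 0 * theta10 0 = theta00 0 ^ 2 := by
      rw [theta01_zero, theta10_zero]
      have := root48_ne_zero
      field_simp
    simp only [hf, wronskian, theta11_zero, h10]
    field_simp
    ring
  have hsym : ∀ z, f (z + thetaZero) = -I * halfMult z ^ 2 * f z := fun z => by
    simp only [hf, hh, theta01_add_thetaZero, theta10_add_thetaZero]
    simp only [wronskian]; ring
  obtain ⟨C, hC⟩ := (exists_eq_mul_theta00_theta11 (f := f) (ε := -1) (ε' := -1) (by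
      have d0 := differentiable_deriv h00
      have d1 := differentiable_deriv h11
      exact ((d0.mul h11).sub (h00.mul d1)).add
        ((differentiable_theta01.mul differentiable_theta10).const_mul _)) f0
    (by rw [← zero_add thetaZero, hsym, f0, mul_zero]) (by simp) (by simp)
    (fun z => by simp only [hf, h1, theta01_add_one, theta10_add_one]; ring)
    (fun z => by simp only [hf, hz, theta01_add_zeta, theta10_add_zeta]; ring)).1
  -- Here ε = ε' = -1, so f may still be a multiple of ϑ_{0,0} ϑ_{1/2,1/2}. That product is odd and
  -- f is even, so f vanishes.
  have heven : ∀ z, f (-z) = f z := fun z => by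
    simp only [hf, wronskian, deriv_of_even theta00_neg, deriv_of_odd theta11_neg, theta00_neg,
      theta01_neg, theta10_neg, theta11_neg]
    ring
  have : f z = 0 := by
    have e := heven z
    rw [hC, hC z, theta00_neg, theta11_neg] at e
    rw [hC]
    linear_combination (-1 / 2 : ℂ) * e
  rw [hf] at this
  linear_combination this

/-! ### The Weierstrass equation N² = D³ + S⁶ and its derivative -/

/-- The function `N = e(-1/8) 27^{1/4} ϑ_{0,0} ϑ_{0,1/2} ϑ_{1/2,0}`; together with
`D = √3 i ϑ_{0,0}² - ϑ_{1/2,1/2}²` and `S = ϑ_{1/2,1/2}` it satisfies `N² = D³ + S⁶`. -/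
def thetaN (z : ℂ) : ℂ :=
  ex (-1 / 8) * (((27 : ℝ) ^ (1 / 4 : ℝ) : ℝ) : ℂ) * theta00 z * theta01 z * theta10 z

lemma thetaDen_eq (z : ℂ) :
    thetaDen z = (Real.sqrt 3 : ℂ) * I * theta00 z ^ 2 - theta11 z ^ 2 := rfl

lemma thetaNumU_eq (z : ℂ) : thetaNumU z = thetaN z * theta11 z := rfl

lemma rpow_27_sq : ((27 : ℝ) ^ (1 / 4 : ℝ)) ^ 2 = 3 * Real.sqrt 3 := by
  rw [← Real.rpow_natCast, ← Real.rpow_mul (by norm_num), show (3 : ℝ) * Real.sqrt 3 = Real.sqrt 27 by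
    rw [show (27 : ℝ) = 3 ^ 2 * 3 by norm_num, Real.sqrt_mul (by norm_num), Real.sqrt_sq (by norm_num)],
    Real.sqrt_eq_rpow]
  norm_num

lemma ex_neg_eighth : ex (-1 / 8) = (root48 ^ 6)⁻¹ := by
  rw [ex, root48, ← Complex.exp_nat_mul, ← Complex.exp_neg]
  congr 1; push_cast; ring

lemma thetaNumT_eq (z : ℂ) : thetaNumT z = thetaN z ^ 2 := by
  have h : ((((27 : ℝ) ^ (1 / 4 : ℝ) : ℝ) : ℂ)) ^ 2 = 3 * Real.sqrt 3 := by
    exact_mod_cast congrArg (fun x : ℝ => (x : ℂ)) rpow_27_sq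
  have h2 : (ex (-1 / 8)) ^ 2 = -I := by
    rw [ex_neg_eighth, inv_pow, ← pow_mul, root48_pow_12, inv_I]
  calc thetaNumT z = -3 * (Real.sqrt 3 : ℂ) * I * theta00 z ^ 2 * theta01 z ^ 2 * theta10 z ^ 2 := rfl
    _ = (ex (-1 / 8)) ^ 2 * (((27 : ℝ) ^ (1 / 4 : ℝ) : ℝ) : ℂ) ^ 2 * theta00 z ^ 2 * theta01 z ^ 2
          * theta10 z ^ 2 := by rw [h, h2]; ring
    _ = thetaN z ^ 2 := by rw [thetaN]; ring

lemma root48_pow_16 : root48 ^ 16 = root48 ^ 8 - 1 := by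
  have := zeta6_sq
  rw [← root48_pow_8] at this
  rw [← this]; ring

lemma sqrt_three_mul_I_sq : ((Real.sqrt 3 : ℂ) * I) ^ 2 = -3 := by
  rw [mul_pow, sqrt_three_sq, I_sq]; ring

lemma sqrt_three_mul_I_ne_zero : (Real.sqrt 3 : ℂ) * I ≠ 0 := fun h => by
  have := sqrt_three_mul_I_sq; rw [h] at this; norm_num at this

/-- With s = √3 i, A = ϑ_{0,0}², B = ϑ_{1/2,1/2}², the quadratic relations give N² = -3sA(A² + sAB -
B²). As s² = -3, this is (sA - B)³ + B³. -/
lemma thetaN_sq (z : ℂ) : thetaN z ^ 2 = thetaDen z ^ 3 + theta11 z ^ 6 := by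
  have h1 : thetaN z ^ 2 = -3 * ((Real.sqrt 3 : ℂ) * I) * theta00 z ^ 2 * theta01 z ^ 2 * theta10 z ^ 2 := by
    rw [← thetaNumT_eq]; change -3 * (Real.sqrt 3 : ℂ) * I * theta00 z ^ 2 * theta01 z ^ 2 * theta10 z ^ 2 = _
    ring
  have h2 : root48 ^ 8 - (root48 ^ 8)⁻¹ = (Real.sqrt 3 : ℂ) * I := by
    have h0 : (1 - root48 ^ 8) * root48 ^ 8 = 1 := by linear_combination -root48_pow_16
    rw [sqrt_three_eq, ← eq_inv_of_mul_eq_one_left h0]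
    ring
  have h3 : theta01 z ^ 2 * theta10 z ^ 2 = theta00 z ^ 4 +
      (Real.sqrt 3 : ℂ) * I * theta00 z ^ 2 * theta11 z ^ 2 - theta11 z ^ 4 := by
    rw [theta01_sq, theta10_sq, ← h2]
    have h0 := root48_ne_zero
    field_simp
    ring
  have h4 := sqrt_three_mul_I_sq
  rw [h1, thetaDen_eq]
  set s := (Real.sqrt 3 : ℂ) * I
  have h5 : s ^ 3 = -3 * s := by rw [pow_succ, h4]
  linear_combination (-3 * s * theta00 z ^ 2) * h3 - theta00 z ^ 6 * h5

/-- The logarithmic derivative relation between `D`, `S` and `N`, with the argument of the constant. -/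
lemma exists_wronskian_const : ∃ c : ℝ, 0 < c ∧ ∀ z,
    deriv thetaDen z * theta11 z - 2 * thetaDen z * deriv theta11 z =
      -(c * (root48 ^ 4)⁻¹ / 3) * thetaN z := by
  obtain ⟨ρ, hρ, h⟩ := exists_hasDerivAt_theta11
  obtain ⟨α, hα, hA⟩ := exists_theta00_zero
  set f : ℝ := (27 : ℝ) ^ (1 / 4 : ℝ) with hf
  have hf0 : 0 < f := by positivity
  have hq : nomeRoot = root48 ^ 3 * (Real.exp (-(Real.pi * Real.sqrt 3 / 8)) : ℝ) := by
    rw [nomeRoot, root48, ← Complex.exp_nat_mul, ofReal_exp, ← Complex.exp_add, zeta6]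
    congr 1; push_cast
    linear_combination (Real.pi * Real.sqrt 3 / 8 : ℂ) * I_sq
  set r := Real.exp (-(Real.pi * Real.sqrt 3 / 8)) with hr
  have hr0 : 0 < r := Real.exp_pos _
  have hpi := Real.pi_pos
  -- All phases are powers of `root48`: 1 from ϑ_{0,0}(0), 3 from `nomeRoot`, -6 from e(-1/8), 12
  -- from i. With `root48 ^ 24 = -1` they combine to `(root48 ^ 4)⁻¹`, leaving a positive factor.
  refine ⟨12 * Real.sqrt 3 * Real.pi * ρ * r / (α * f), by positivity, fun z => ?_⟩
  have hd : deriv thetaDen z = (Real.sqrt 3 : ℂ) * I * (2 * theta00 z * deriv theta00 z) -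
      2 * theta11 z * deriv theta11 z := by
    have h0 := (differentiable_theta00 z).hasDerivAt
    have h1 := (differentiable_theta11 z).hasDerivAt
    have := ((h0.pow 2).const_mul ((Real.sqrt 3 : ℂ) * I)).sub (h1.pow 2)
    rw [show thetaDen = _ from funext thetaDen_eq]
    refine this.deriv.trans ?_
    norm_num
  have hw := wronskian_theta00_theta11 z
  rw [wronskian, h.deriv, hA, hq] at hw
  have h24 : root48 ^ 24 = -1 := by
    rw [show 24 = 12 * 2 by norm_num, pow_mul, root48_pow_12, I_sq]
  have hα' : (α : ℂ) ≠ 0 := by exact_mod_cast hα.ne'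
  have hf' : (f : ℂ) ≠ 0 := by exact_mod_cast hf0.ne'
  have h48 := root48_ne_zero
  calc deriv thetaDen z * theta11 z - 2 * thetaDen z * deriv theta11 z
      = 2 * ((Real.sqrt 3 : ℂ) * I) * theta00 z *
          (deriv theta00 z * theta11 z - theta00 z * deriv theta11 z) := by
        rw [hd, thetaDen_eq]; ring
    _ = _ := by
        rw [hw, thetaN, ex_neg_eighth, ← root48_pow_12, ← hf]
        push_cast
        field_simp
        linear_combination (12 * ρ * r * theta00 z * theta01 z * theta10 z : ℂ) * h24

lemma differentiable_thetaDen : Differentiable ℂ thetaDen :=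
  ((differentiable_theta00.pow 2).const_mul _).sub (differentiable_theta11.pow 2)

lemma differentiable_thetaN : Differentiable ℂ thetaN :=
  ((differentiable_theta00.const_mul _).mul differentiable_theta01).mul differentiable_theta10

lemma thetaDen_add_one (z : ℂ) : thetaDen (z + 1) = thetaDen z := by
  rw [thetaDen_eq, thetaDen_eq, theta00_add_one, theta11_add_one]; ring

lemma thetaN_add_one (z : ℂ) : thetaN (z + 1) = -thetaN z := by
  rw [thetaN, thetaN, theta00_add_one, theta01_add_one, theta10_add_one]; ring

lemma thetaDen_add_zeta (z : ℂ) : thetaDen (z + zeta6) = thetaMult z ^ 2 * thetaDen z := by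
  rw [thetaDen_eq, thetaDen_eq, theta00_add_zeta, theta11_add_zeta]; ring

lemma thetaN_add_zeta (z : ℂ) : thetaN (z + zeta6) = -thetaMult z ^ 3 * thetaN z := by
  rw [thetaN, thetaN, theta00_add_zeta, theta01_add_zeta, theta10_add_zeta]; ring

lemma thetaDen_neg (z : ℂ) : thetaDen (-z) = thetaDen z := by
  rw [thetaDen_eq, thetaDen_eq, theta00_neg, theta11_neg]; ring

lemma thetaN_neg (z : ℂ) : thetaN (-z) = thetaN z := by
  rw [thetaN, thetaN, theta00_neg, theta01_neg, theta10_neg]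

/-- A common zero of D and S would be one of ϑ_{0,0} and ϑ_{1/2,1/2}; then `thetaZero` would be a
lattice point and ϑ_{0,0}(0) = 0. -/
lemma thetaDen_ne_zero_of_theta11 {z : ℂ} (h : theta11 z = 0) : thetaDen z ≠ 0 := by
  rw [thetaDen_eq, h]
  have h0 : theta00 z ≠ 0 := fun h1 => theta00_zero_ne_zero (theta00_eq_zero.mpr (by
    have := sub_mem (theta00_eq_zero.mp h1) (theta11_eq_zero.mp h)
    convert this using 1; ring))
  rw [zero_pow two_ne_zero, sub_zero]
  exact mul_ne_zero sqrt_three_mul_I_ne_zero (pow_ne_zero 2 h0)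

lemma theta11_ne_zero_of_thetaDen {z : ℂ} (h : thetaDen z = 0) : theta11 z ≠ 0 :=
  fun h1 => thetaDen_ne_zero_of_theta11 h1 h

/-- The three theta factors of N vanish only at half-periods. At such points z and -z agree modulo
the lattice. -/
lemma thetaN_eq_zero_imp {z : ℂ} (h : thetaN z = 0) : 2 * z ∈ latticeZeta := by
  have key : ∀ w : ℂ, 2 * w ∈ latticeZeta → z - w ∈ latticeZeta → 2 * z ∈ latticeZeta := by
    intro w h1 h2
    have := add_mem h1 (add_mem h2 h2)
    convert this using 1; ring
  have hc : ex (-1 / 8) * (((27 : ℝ) ^ (1 / 4 : ℝ) : ℝ) : ℂ) ≠ 0 := by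
    refine mul_ne_zero (Complex.exp_ne_zero _) ?_
    have : (0 : ℝ) < (27 : ℝ) ^ (1 / 4 : ℝ) := by positivity
    exact_mod_cast this.ne'
  rw [thetaN, mul_eq_zero, mul_eq_zero, mul_eq_zero] at h
  rcases h with ((h | h) | h) | h
  · exact absurd h hc
  · refine key thetaZero ?_ (theta00_eq_zero.mp h)
    rw [show 2 * thetaZero = 1 + zeta6 by rw [thetaZero]; ring]
    exact add_mem one_mem_latticeZeta zeta6_mem_latticeZeta
  · refine key (zeta6 / 2) ?_ (theta01_eq_zero.mp h)
    rw [mul_div_cancel₀ _ two_ne_zero]; exact zeta6_mem_latticeZeta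
  · refine key (1 / 2) ?_ (theta10_eq_zero.mp h)
    rw [mul_div_cancel₀ _ two_ne_zero]; exact one_mem_latticeZeta

/-! ### The correspondence between ℂ modulo the lattice and the curve -/

/-- `Param z P`: the point `P` of the curve has the coordinates given by the theta quotients
at `z`. -/
def Param (z : ℂ) : CZeta → Prop
  | .finite t u _ _ => thetaDen z ≠ 0 ∧ thetaN z ^ 2 = t * thetaDen z ^ 3 ∧
      thetaN z * theta11 z = u * thetaDen z ^ 2
  | .zero v _ => thetaDen z ≠ 0 ∧ thetaN z = 0 ∧ theta11 z ^ 2 = v * thetaDen z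
  | .infinity y _ => thetaDen z = 0 ∧ thetaN z = y * theta11 z ^ 3

lemma exists_param (z : ℂ) : ∃ P, Param z P := by
  have h := thetaN_sq z
  by_cases hD : thetaDen z = 0
  · have hS := theta11_ne_zero_of_thetaDen hD
    refine ⟨.infinity (thetaN z / theta11 z ^ 3) ?_, hD, ?_⟩
    · rw [div_pow, h, hD]; field_simp; ring
    · field_simp
  · by_cases hN : thetaN z = 0
    · refine ⟨.zero (theta11 z ^ 2 / thetaDen z) ?_, hD, hN, ?_⟩
      · rw [hN] at h
        field_simp
        linear_combination -h
      · field_simp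
    · refine ⟨.finite (thetaN z ^ 2 / thetaDen z ^ 3) (thetaN z * theta11 z / thetaDen z ^ 2) ?_ ?_,
        hD, ?_, ?_⟩
      · simp [hD, hN]
      · field_simp
        linear_combination -h
      · field_simp
      · field_simp

lemma param_add_mem {l : ℂ} (hl : l ∈ latticeZeta) (z : ℂ) (P : CZeta) :
    Param (z + l) P ↔ Param z P := by
  refine latticeZeta_induction (p := fun z => Param z P) (fun z => ?_) (fun z => ?_) hl z
  · cases P <;> simp only [Param, thetaDen_add_one, thetaN_add_one, theta11_add_one]
    · simp
    · simp
    · rw [neg_pow, show (-1 : ℂ) ^ 3 = -1 by norm_num]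
      simp
  · have hm := thetaMult_ne_zero z
    cases P with
    | finite t u ht h =>
      simp only [Param, thetaDen_add_zeta, thetaN_add_zeta, theta11_add_zeta]
      rw [← mul_right_inj' (pow_ne_zero 6 hm) (b := thetaN z ^ 2),
        ← mul_right_inj' (pow_ne_zero 4 hm) (b := thetaN z * theta11 z)]
      simp only [ne_eq, mul_eq_zero, pow_eq_zero_iff, OfNat.ofNat_ne_zero, not_false_eq_true, hm,
        false_or]
      ring_nf
    | zero v h =>
      simp only [Param, thetaDen_add_zeta, thetaN_add_zeta, theta11_add_zeta]
      rw [← mul_right_inj' (pow_ne_zero 2 hm) (b := theta11 z ^ 2)]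
      simp only [ne_eq, mul_eq_zero, pow_eq_zero_iff, OfNat.ofNat_ne_zero, not_false_eq_true, hm,
        false_or, neg_eq_zero]
      ring_nf
    | infinity y h =>
      simp only [Param, thetaDen_add_zeta, thetaN_add_zeta, theta11_add_zeta]
      rw [← mul_right_inj' (neg_ne_zero.mpr (pow_ne_zero 3 hm)) (b := thetaN z)]
      simp only [ne_eq, mul_eq_zero, pow_eq_zero_iff, OfNat.ofNat_ne_zero, not_false_eq_true, hm,
        false_or]
      ring_nf

/-- Equality of D/S² makes the right side of the addition formula vanish, so w ≡ z or w ≡ -z. In the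
second case N/S³ is odd and takes equal values, so N(z) = 0, z is a half-period, and again w ≡ z. -/
lemma sub_mem_of_eq {z w : ℂ} (h1 : thetaDen z * theta11 w ^ 2 = thetaDen w * theta11 z ^ 2)
    (h2 : thetaN z * theta11 w ^ 3 = thetaN w * theta11 z ^ 3) (hw : theta11 w ≠ 0) :
    z - w ∈ latticeZeta := by
  have h := theta11_add_mul_theta11_sub z w
  have h3 : (Real.sqrt 3 : ℂ) * I * (theta11 z ^ 2 * theta00 w ^ 2 - theta00 z ^ 2 * theta11 w ^ 2) = 0 := by
    rw [thetaDen_eq, thetaDen_eq] at h1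
    linear_combination -h1
  rw [← h] at h3
  have h4 : theta11 (z + w) * theta11 (z - w) = 0 := by
    simpa [sqrt_three_mul_I_ne_zero, theta00_zero_ne_zero, -mul_eq_zero] using
      (mul_eq_zero.mp ((mul_eq_zero.mp h3).resolve_left sqrt_three_mul_I_ne_zero)).resolve_left
        (pow_ne_zero 2 theta00_zero_ne_zero)
  rcases mul_eq_zero.mp h4 with h5 | h5
  · have hl := theta11_eq_zero.mp h5
    have h6 := (latticeZeta_induction
      (p := fun x => thetaN x * theta11 z ^ 3 = -(thetaN z) * theta11 x ^ 3)
      (fun x => by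
        rw [thetaN_add_one, theta11_add_one, ← neg_inj]
        ring_nf)
      (fun x => by
        rw [thetaN_add_zeta, theta11_add_zeta,
          ← mul_right_inj' (neg_ne_zero.mpr (pow_ne_zero 3 (thetaMult_ne_zero x)))
            (b := thetaN x * theta11 z ^ 3)]
        ring_nf) hl (-z)).mpr (by
          rw [thetaN_neg, theta11_neg]; ring)
    rw [show -z + (z + w) = w by ring, ← h2] at h6
    have h7 : thetaN z = 0 := by
      have : thetaN z * theta11 w ^ 3 = 0 := by linear_combination (1 / 2 : ℂ) * h6
      exact (mul_eq_zero.mp this).resolve_right (pow_ne_zero 3 hw)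
    have := sub_mem (thetaN_eq_zero_imp h7) hl
    convert this using 1; ring
  · exact theta11_eq_zero.mp h5

/-- The affine coordinates in terms of `x = t / u²`, `y = t² / u³`. -/
lemma Param.finite_iff {z t u : ℂ} {ht : t ≠ 0} {h : u ^ 6 = t ^ 3 * (t - 1)} (hu : u ≠ 0) :
    Param z (.finite t u ht h) ↔ theta11 z ≠ 0 ∧ thetaDen z = t / u ^ 2 * theta11 z ^ 2 ∧
      thetaN z = t ^ 2 / u ^ 3 * theta11 z ^ 3 := by
  simp only [Param]
  constructor
  · rintro ⟨hD, h1, h2⟩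
    have hS : theta11 z ≠ 0 := fun h0 => by
      rw [h0, mul_zero] at h2
      exact mul_ne_zero hu (pow_ne_zero 2 hD) h2.symm
    have h3 : thetaDen z = t / u ^ 2 * theta11 z ^ 2 := by
      have : thetaDen z ^ 3 * (t * theta11 z ^ 2 - u ^ 2 * thetaDen z) = 0 := by
        linear_combination -theta11 z ^ 2 * h1 + (thetaN z * theta11 z + u * thetaDen z ^ 2) * h2
      have := (mul_eq_zero.mp this).resolve_left (pow_ne_zero 3 hD)
      field_simp
      linear_combination -this
    refine ⟨hS, h3, ?_⟩
    rw [h3] at h2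
    apply mul_right_cancel₀ hS
    rw [h2]; field_simp
  · rintro ⟨hS, h1, h2⟩
    rw [h1, h2]
    refine ⟨by simp [ht, hu, hS], ?_, ?_⟩
    · field_simp
    · field_simp

lemma Param.sub_mem {z w : ℂ} {P : CZeta} (hz : Param z P) (hw : Param w P) :
    z - w ∈ latticeZeta := by
  cases P with
  | finite t u ht h =>
    by_cases hu : u = 0
    · have key : ∀ {z : ℂ}, Param z (.finite t u ht h) → z ∈ latticeZeta := by
        rintro z ⟨h1, h2, h3⟩
        have hN : thetaN z ≠ 0 := fun h0 => by
          rw [h0] at h2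
          exact mul_ne_zero ht (pow_ne_zero 3 h1) (by rw [← h2]; ring)
        rw [hu, zero_mul] at h3
        exact theta11_eq_zero.mp ((mul_eq_zero.mp h3).resolve_left hN)
      exact AddSubgroup.sub_mem _ (key hz) (key hw)
    · obtain ⟨s1, d1, n1⟩ := (Param.finite_iff hu).mp hz
      obtain ⟨s2, d2, n2⟩ := (Param.finite_iff hu).mp hw
      exact sub_mem_of_eq (by rw [d1, d2]; ring) (by rw [n1, n2]; ring) s2
  | zero v h =>
    obtain ⟨d1, n1, s1⟩ := hz
    obtain ⟨d2, n2, s2⟩ := hw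
    have hv : v ≠ 0 := fun h0 => by rw [h0] at h; norm_num at h
    refine sub_mem_of_eq (by rw [s1, s2]; ring) (by rw [n1, n2]; ring) fun h0 => ?_
    rw [h0] at s2
    exact mul_ne_zero hv d2 (by rw [← s2]; ring)
  | infinity y h =>
    obtain ⟨d1, n1⟩ := hz
    obtain ⟨d2, n2⟩ := hw
    exact sub_mem_of_eq (by rw [d1, d2]; ring) (by rw [n1, n2]; ring)
      (theta11_ne_zero_of_thetaDen d2)

lemma thetaDen_zero_ne_zero : thetaDen 0 ≠ 0 := thetaDen_ne_zero_of_theta11 theta11_zero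

lemma thetaN_zero_ne_zero : thetaN 0 ≠ 0 := fun h => by
  have := thetaN_sq 0
  rw [h, theta11_zero] at this
  exact pow_ne_zero 3 thetaDen_zero_ne_zero (by linear_combination -this)

lemma exists_theta11_ne_zero : ∃ z, theta11 z ≠ 0 := by
  by_contra! h
  exact deriv_theta11_zero_ne_zero (by rw [show theta11 = fun _ => 0 from funext h]; simp)

/-- The function `x = D / S²` takes every value. -/
lemma exists_thetaDen_eq (c : ℂ) : ∃ z, theta11 z ≠ 0 ∧ thetaDen z = c * theta11 z ^ 2 := by
  by_contra! hcon
  have hne : ∀ z, thetaDen z - c * theta11 z ^ 2 ≠ 0 := fun z h0 => by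
    by_cases hS : theta11 z = 0
    · rw [hS] at h0
      exact thetaDen_ne_zero_of_theta11 hS (by linear_combination h0)
    · exact hcon z hS (by linear_combination h0)
  -- If D - cS² had no zero, S²/(D - cS²) would be entire and periodic, hence constant; it vanishes
  -- at 0 but not identically.
  obtain ⟨C, hC⟩ := exists_eq_const_of_periodic
    (h := fun z => theta11 z ^ 2 / (thetaDen z - c * theta11 z ^ 2))
    ((differentiable_theta11.pow 2).div
      (differentiable_thetaDen.sub ((differentiable_theta11.pow 2).const_mul c)) hne)
    (fun z => by rw [theta11_add_one, thetaDen_add_one]; ring_nf)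
    (fun z => by
      have hm := thetaMult_ne_zero z
      rw [theta11_add_zeta, thetaDen_add_zeta]
      rw [show (-thetaMult z * theta11 z) ^ 2 = thetaMult z ^ 2 * theta11 z ^ 2 by ring,
        show thetaMult z ^ 2 * thetaDen z - c * (thetaMult z ^ 2 * theta11 z ^ 2) =
          thetaMult z ^ 2 * (thetaDen z - c * theta11 z ^ 2) by ring,
        mul_div_mul_left _ _ (pow_ne_zero 2 hm)])
  have h0 := hC 0
  simp only [theta11_zero] at h0
  obtain ⟨z, hz⟩ := exists_theta11_ne_zero
  have h1 := hC z
  rw [← h0] at h1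
  simp [hz, hne] at h1

/-- The value of D/S² fixes N/S³ up to sign, and z ↦ -z corrects the sign. -/
lemma exists_thetaDen_thetaN_eq {c y : ℂ} (h : y ^ 2 = c ^ 3 + 1) :
    ∃ z, theta11 z ≠ 0 ∧ thetaDen z = c * theta11 z ^ 2 ∧ thetaN z = y * theta11 z ^ 3 := by
  obtain ⟨z, hz, hD⟩ := exists_thetaDen_eq c
  have h1 : (thetaN z) ^ 2 = (y * theta11 z ^ 3) ^ 2 := by
    rw [thetaN_sq, hD]; linear_combination -theta11 z ^ 6 * h
  rcases sq_eq_sq_iff_eq_or_eq_neg.mp h1 with h2 | h2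
  · exact ⟨z, hz, hD, h2⟩
  · refine ⟨-z, ?_, ?_, ?_⟩
    · rw [theta11_neg]; exact neg_ne_zero.mpr hz
    · rw [theta11_neg, thetaDen_neg, hD]; ring
    · rw [theta11_neg, thetaN_neg, h2]; ring

lemma param_zero : Param 0 CZeta.P₁ := by
  refine ⟨thetaDen_zero_ne_zero, ?_, ?_⟩
  · rw [thetaN_sq, theta11_zero]; ring
  · rw [theta11_zero]; ring

/-- In the model y² = x³ + 1, P₁ is the origin z = 0, the points above (t, u) = (0, 0) are (1/v, 0),
and those at infinity are (0, y). -/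
lemma exists_param_eq (P : CZeta) : ∃ z, Param z P := by
  cases P with
  | finite t u ht h =>
    by_cases hu : u = 0
    · subst hu
      have : t = 1 := by
        have h1 : t ^ 3 * (t - 1) = 0 := by rw [← h]; ring
        have := (mul_eq_zero.mp h1).resolve_left (pow_ne_zero 3 ht)
        linear_combination this
      subst this
      exact ⟨0, param_zero⟩
    · obtain ⟨z, hz⟩ := exists_thetaDen_thetaN_eq (c := t / u ^ 2) (y := t ^ 2 / u ^ 3) (by
        field_simp
        linear_combination -h)
      exact ⟨z, (Param.finite_iff hu).mpr hz⟩
  | zero v h =>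
    have hv : v ≠ 0 := fun h0 => by rw [h0] at h; norm_num at h
    obtain ⟨z, hz, h1, h2⟩ := exists_thetaDen_thetaN_eq (c := 1 / v) (y := 0) (by
      field_simp; linear_combination -h)
    refine ⟨z, ?_, ?_, ?_⟩
    · rw [h1]; simp [hv, hz]
    · rw [h2]; ring
    · rw [h1]; field_simp
  | infinity y h =>
    obtain ⟨z, hz, h1, h2⟩ := exists_thetaDen_thetaN_eq (c := 0) (y := y) (by rw [h]; ring)
    exact ⟨z, by rw [h1]; ring, h2⟩

/-! ### The theta quotients near arbitrary points -/

lemma eventually_ne_zero {f : ℂ → ℂ} (hf : Differentiable ℂ f) {a : ℂ} (ha : f a ≠ 0) (z : ℂ) :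
    ∀ᶠ w in 𝓝[≠] z, f w ≠ 0 := by
  have h4 := (hf.differentiableOn (s := Set.univ)).analyticOnNhd isOpen_univ
  rcases (h4 z (Set.mem_univ z)).eventually_eq_zero_or_eventually_ne_zero with h | h
  · exact absurd (h4.eqOn_zero_of_preconnected_of_eventuallyEq_zero isPreconnected_univ
      (Set.mem_univ z) h (Set.mem_univ a)) ha
  · exact h

/-- The points at which the theta quotients avoid the ramification points of `t`. -/
def regularSet : Set ℂ := {w | thetaDen w ≠ 0 ∧ thetaN w ≠ 0 ∧ theta11 w ≠ 0}

lemma regularSet_mem_nhdsNE (z : ℂ) : regularSet ∈ 𝓝[≠] z := by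
  obtain ⟨a, ha⟩ := exists_theta11_ne_zero
  filter_upwards [eventually_ne_zero differentiable_thetaDen thetaDen_zero_ne_zero z,
    eventually_ne_zero differentiable_thetaN thetaN_zero_ne_zero z,
    eventually_ne_zero differentiable_theta11 ha z] with w h1 h2 h3
  exact ⟨h1, h2, h3⟩

lemma isOpen_regularSet : IsOpen regularSet :=
  (isOpen_ne_fun differentiable_thetaDen.continuous continuous_const).inter
    ((isOpen_ne_fun differentiable_thetaN.continuous continuous_const).inter
    (isOpen_ne_fun differentiable_theta11.continuous continuous_const))

/-- The coordinate `t` as a theta quotient. -/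
def quotT (z : ℂ) : ℂ := thetaNumT z / thetaDen z ^ 3

/-- The coordinate `u` as a theta quotient. -/
def quotU (z : ℂ) : ℂ := thetaNumU z / thetaDen z ^ 2

lemma quotT_eq (z : ℂ) : quotT z = thetaN z ^ 2 / thetaDen z ^ 3 := by rw [quotT, thetaNumT_eq]

lemma quotU_eq (z : ℂ) : quotU z = thetaN z * theta11 z / thetaDen z ^ 2 := by
  rw [quotU, thetaNumU_eq]

lemma quotT_sub_one {z : ℂ} (h : thetaDen z ≠ 0) : quotT z - 1 = theta11 z ^ 6 / thetaDen z ^ 3 := by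
  rw [quotT_eq]; field_simp; linear_combination thetaN_sq z

lemma quot_ratio {z : ℂ} (h : z ∈ regularSet) :
    quotU z ^ 3 / (quotT z * (quotT z - 1)) = thetaN z / theta11 z ^ 3 := by
  obtain ⟨h1, h2, h3⟩ := h
  rw [quotT_sub_one h1, quotT_eq, quotU_eq]
  field_simp

/-- The theta quotients approach the point they parametrize. -/
lemma Param.approaches {z : ℂ} {P : CZeta} (h : Param z P) {α : Type} {l : Filter α} {f : α → ℂ}
    (hf : Tendsto f l (𝓝 z)) (hr : ∀ᶠ a in l, f a ∈ regularSet) :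
    CZeta.Approaches l (fun a => quotT (f a)) (fun a => quotU (f a)) P := by
  have cD := (differentiable_thetaDen.continuous.tendsto z).comp hf
  have cN := (differentiable_thetaN.continuous.tendsto z).comp hf
  have cS := (differentiable_theta11.continuous.tendsto z).comp hf
  cases P with
  | finite t u ht hh =>
    obtain ⟨hD, h1, h2⟩ := h
    refine ⟨?_, ?_⟩
    · simp_rw [quotT_eq]
      have := (cN.pow 2).div (cD.pow 3) (pow_ne_zero 3 hD)
      rw [h1, mul_div_cancel_right₀ _ (pow_ne_zero 3 hD)] at this
      exact this
    · simp_rw [quotU_eq]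
      have := (cN.mul cS).div (cD.pow 2) (pow_ne_zero 2 hD)
      rw [h2, mul_div_cancel_right₀ _ (pow_ne_zero 2 hD)] at this
      exact this
  | zero v hh =>
    obtain ⟨hD, h1, h2⟩ := h
    refine ⟨?_, ?_⟩
    · simp_rw [quotT_eq]
      have := (cN.pow 2).div (cD.pow 3) (pow_ne_zero 3 hD)
      rw [h1, zero_pow two_ne_zero, zero_div] at this
      exact this
    · have := (cS.pow 2).div cD hD
      rw [h2, mul_div_cancel_right₀ _ hD] at this
      refine this.congr' ?_
      filter_upwards [hr] with a ha
      obtain ⟨g1, g2, g3⟩ := ha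
      simp only [Function.comp_apply, Pi.div_apply]
      rw [quotT_eq, quotU_eq]
      field_simp
  | infinity y hh =>
    obtain ⟨hD, h1⟩ := h
    have hS := theta11_ne_zero_of_thetaDen hD
    have hy : y ≠ 0 := fun h0 => by rw [h0] at hh; norm_num at hh
    have hN : thetaN z ≠ 0 := by rw [h1]; exact mul_ne_zero hy (pow_ne_zero 3 hS)
    refine ⟨?_, ?_⟩
    · have h3 := (cD.pow 3).div (cN.pow 2) (pow_ne_zero 2 hN)
      rw [hD, zero_pow three_ne_zero, zero_div] at h3
      have h4 : Tendsto (fun a => (quotT (f a))⁻¹) l (𝓝[≠] 0) := by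
        refine tendsto_nhdsWithin_iff.mpr ⟨?_, ?_⟩
        · simp_rw [quotT_eq, inv_div]
          exact h3
        · filter_upwards [hr] with a ha
          obtain ⟨g1, g2, g3⟩ := ha
          rw [quotT_eq]
          simp [g1, g2]
      have := Filter.tendsto_inv₀_nhdsNE_zero.comp h4
      simpa [Function.comp_def] using this
    · have := cN.div (cS.pow 3) (pow_ne_zero 3 hS)
      rw [h1, mul_div_cancel_right₀ _ (pow_ne_zero 3 hS)] at this
      refine this.congr' ?_
      filter_upwards [hr] with a ha
      exact (quot_ratio ha).symm

/-- The non-singular model is separated: where t and u do not distinguish points, the limits of u²/t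
or u³/(t(t-1)) do. -/
lemma approaches_unique {α : Type} {l : Filter α} [l.NeBot] {T U : α → ℂ} {P Q : CZeta}
    (hP : CZeta.Approaches l T U P) (hQ : CZeta.Approaches l T U Q) : P = Q := by
  have key : ∀ {t : ℂ}, Tendsto T l (𝓝 t) → ¬ Tendsto T l (Bornology.cobounded ℂ) := fun {t} h1 h2 =>
    h1.not_tendsto (Metric.disjoint_nhds_cobounded t) h2
  cases P with
  | finite t u ht h =>
    cases Q with
    | finite t' u' ht' h' =>
      obtain rfl := tendsto_nhds_unique hP.1 hQ.1
      obtain rfl := tendsto_nhds_unique hP.2 hQ.2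
      rfl
    | zero v' h' => exact absurd (tendsto_nhds_unique hP.1 hQ.1) ht
    | infinity y' h' => exact absurd hQ.1 (key hP.1)
  | zero v h =>
    cases Q with
    | finite t' u' ht' h' => exact absurd (tendsto_nhds_unique hQ.1 hP.1) ht'
    | zero v' h' =>
      obtain rfl := tendsto_nhds_unique hP.2 hQ.2
      rfl
    | infinity y' h' => exact absurd hQ.1 (key hP.1)
  | infinity y h =>
    cases Q with
    | finite t' u' ht' h' => exact absurd hP.1 (key hQ.1)
    | zero v' h' => exact absurd hP.1 (key hQ.1)
    | infinity y' h' =>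
      obtain rfl := tendsto_nhds_unique hP.2 hQ.2
      rfl

lemma Param.approaches_nhdsNE {z : ℂ} {P : CZeta} (h : Param z P) :
    CZeta.Approaches (𝓝[≠] z) quotT quotU P :=
  h.approaches (f := fun w => w) (tendsto_id.mono_left nhdsWithin_le_nhds) (regularSet_mem_nhdsNE z)

lemma Param.unique {z : ℂ} {P Q : CZeta} (hP : Param z P) (hQ : Param z Q) : P = Q :=
  approaches_unique hP.approaches_nhdsNE hQ.approaches_nhdsNE

lemma Param.coord {z : ℂ} {P : CZeta} (h : Param z P) :
    (thetaNumT z ≠ 0 ∨ thetaDen z ≠ 0) ∧ (thetaNumU z ≠ 0 ∨ thetaDen z ≠ 0) ∧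
      P.coordT = projQuot (thetaNumT z) (thetaDen z ^ 3) ∧
      P.coordU = projQuot (thetaNumU z) (thetaDen z ^ 2) := by
  rw [thetaNumT_eq, thetaNumU_eq]
  cases P with
  | finite t u ht hh =>
    obtain ⟨hD, h1, h2⟩ := h
    refine ⟨Or.inr hD, Or.inr hD, ?_, ?_⟩
    · simp [projQuot, hD, h1, CZeta.coordT]
    · simp [projQuot, hD, h2, CZeta.coordU]
  | zero v hh =>
    obtain ⟨hD, h1, h2⟩ := h
    refine ⟨Or.inr hD, Or.inr hD, ?_, ?_⟩
    · simp [projQuot, hD, h1, CZeta.coordT]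
    · simp [projQuot, hD, h1, CZeta.coordU]
  | infinity y hh =>
    obtain ⟨hD, h1⟩ := h
    have hS := theta11_ne_zero_of_thetaDen hD
    have hy : y ≠ 0 := fun h0 => by rw [h0] at hh; norm_num at hh
    have hN : thetaN z ≠ 0 := by rw [h1]; exact mul_ne_zero hy (pow_ne_zero 3 hS)
    refine ⟨Or.inl (pow_ne_zero 2 hN), Or.inl (mul_ne_zero hN hS), ?_, ?_⟩
    · simp [projQuot, hD, CZeta.coordT]
    · simp [projQuot, hD, CZeta.coordU]

/-! ### The differential equation and the lifting of arcs -/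

section
variable {κ : ℂ}

/-- The relation between `κ` and the logarithmic derivative of `D / S²`. -/
def IsWronskianConst (κ : ℂ) : Prop :=
  ∀ z, deriv thetaDen z * theta11 z - 2 * thetaDen z * deriv theta11 z = -(κ / 3) * thetaN z

lemma hasDerivAt_quotX (hκ : IsWronskianConst κ) {z : ℂ} (hS : theta11 z ≠ 0) :
    HasDerivAt (fun z => thetaDen z / theta11 z ^ 2) (-(κ / 3) * (thetaN z / theta11 z ^ 3)) z := by
  have hD := (differentiable_thetaDen z).hasDerivAt
  have hS' := (differentiable_theta11 z).hasDerivAt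
  refine (hD.div (hS'.pow 2) (pow_ne_zero 2 hS)).congr_deriv ?_
  have := hκ z
  norm_num
  field_simp
  linear_combination 3 * this

lemma hasDerivAt_quotY (hκ : IsWronskianConst κ) {z : ℂ} (hS : theta11 z ≠ 0) (hN : thetaN z ≠ 0) :
    HasDerivAt (fun z => thetaN z / theta11 z ^ 3) (-(κ / 2) * (thetaDen z / theta11 z ^ 2) ^ 2) z := by
  have hD := (differentiable_thetaDen z).hasDerivAt
  have hS' := (differentiable_theta11 z).hasDerivAt
  have hN' := (differentiable_thetaN z).hasDerivAt
  refine (hN'.div (hS'.pow 3) (pow_ne_zero 3 hS)).congr_deriv ?_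
  have h1 := hκ z
  -- The derivative of N² = D³ + S⁶; it gives N' only after cancelling N, which is nonzero here.
  have h2 : 2 * thetaN z * deriv thetaN z =
      3 * thetaDen z ^ 2 * deriv thetaDen z + 6 * theta11 z ^ 5 * deriv theta11 z := by
    have e1 := hN'.pow 2
    have e2 := (hD.pow 3).add (hS'.pow 6)
    rw [show thetaN ^ 2 = thetaDen ^ 3 + theta11 ^ 6 from funext thetaN_sq] at e1
    have := e1.unique e2
    norm_num at this
    exact this
  have h3 := thetaN_sq z
  norm_num
  field_simp
  apply mul_left_cancel₀ hN
  linear_combination theta11 z * h2 + 3 * thetaDen z ^ 2 * h1 - 6 * deriv theta11 z * h3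

/-- In coordinates, this says that u dt/(t(t-1)) pulls back to κ dz. Writing t = 1 + S⁶/D³ avoids
the derivative of N. -/
lemma hasDerivAt_quotT (hκ : IsWronskianConst κ) {z : ℂ} (hz : z ∈ regularSet) :
    HasDerivAt quotT (κ * (quotT z * (quotT z - 1) / quotU z)) z := by
  obtain ⟨hD0, hN0, hS0⟩ := hz
  have hD := (differentiable_thetaDen z).hasDerivAt
  have hS' := (differentiable_theta11 z).hasDerivAt
  have h1 := ((hS'.pow 6).div (hD.pow 3) (pow_ne_zero 3 hD0)).const_add 1
  have h2 : quotT =ᶠ[𝓝 z] fun w => 1 + (theta11 ^ 6 / thetaDen ^ 3) w := by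
    filter_upwards [differentiable_thetaDen.continuous.continuousAt.eventually_ne hD0] with w hw
    have := quotT_sub_one hw
    simp only [Pi.div_apply, Pi.pow_apply]
    linear_combination this
  refine (h1.congr_of_eventuallyEq h2).congr_deriv ?_
  have h3 := hκ z
  rw [quotT_sub_one hD0, quotT_eq, quotU_eq]
  norm_num
  field_simp
  linear_combination -3 * h3

/-- Splits the two-sided improper integral into one-sided limits of a primitive: subtracting two
differences with the same first argument shows that F is Cauchy along l₂. -/
lemma exists_tendsto_of_tendsto_sub {α : Type*} {l₁ l₂ : Filter α} [l₁.NeBot] [l₂.NeBot]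
    {F : α → ℂ} {w : ℂ} (h : Tendsto (fun p : α × α => F p.2 - F p.1) (l₁ ×ˢ l₂) (𝓝 w)) :
    ∃ a b, Tendsto F l₁ (𝓝 a) ∧ Tendsto F l₂ (𝓝 b) ∧ b - a = w := by
  have hc : Cauchy (map F l₂) := by
    rw [cauchy_map_iff]
    refine ⟨inferInstance, ?_⟩
    rw [uniformity_eq_comap_nhds_zero, tendsto_comap_iff]
    have e1 : Tendsto (fun q : α × α × α => (q.1, q.2.1)) (l₁ ×ˢ l₂ ×ˢ l₂) (l₁ ×ˢ l₂) :=
      tendsto_fst.prodMk (tendsto_fst.comp tendsto_snd)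
    have e2 : Tendsto (fun q : α × α × α => (q.1, q.2.2)) (l₁ ×ˢ l₂ ×ˢ l₂) (l₁ ×ˢ l₂) :=
      tendsto_fst.prodMk (tendsto_snd.comp tendsto_snd)
    have e3 := (h.comp e2).sub (h.comp e1)
    rw [← map_snd_prod l₁ (l₂ ×ˢ l₂), tendsto_map'_iff]
    rw [sub_self] at e3
    refine e3.congr fun q => ?_
    simp
  obtain ⟨b, hb⟩ := CompleteSpace.complete hc
  have hb' : Tendsto F l₂ (𝓝 b) := hb
  refine ⟨b - w, b, ?_, hb', by ring⟩
  have e := (hb'.comp (tendsto_snd (f := l₁))).sub h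
  rw [← map_fst_prod l₁ l₂, tendsto_map'_iff]
  refine e.congr fun q => ?_
  simp

/-- Uniqueness for the differential equation of `(x, y) = (D / S², N / S³)` along a path. -/
lemma lift_unique (hκ : IsWronskianConst κ) (hκ0 : κ ≠ 0) {X Y g Z : ℝ → ℂ}
    (hg : ContinuousOn g (Set.Ioo 0 1))
    (hX : ∀ s ∈ Set.Ioo (0 : ℝ) 1, HasDerivAt X (g s * (-(Y s) / 3)) s)
    (hY : ∀ s ∈ Set.Ioo (0 : ℝ) 1, HasDerivAt Y (g s * (-(X s) ^ 2 / 2)) s)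
    (hZ : ∀ s ∈ Set.Ioo (0 : ℝ) 1, HasDerivAt Z (g s / κ) s)
    (hY0 : ∀ s ∈ Set.Ioo (0 : ℝ) 1, Y s ≠ 0)
    (h0 : ∃ s ∈ Set.Ioo (0 : ℝ) 1, theta11 (Z s) ≠ 0 ∧ thetaDen (Z s) = X s * theta11 (Z s) ^ 2 ∧
      thetaN (Z s) = Y s * theta11 (Z s) ^ 3) :
    ∀ s ∈ Set.Ioo (0 : ℝ) 1, theta11 (Z s) ≠ 0 ∧ thetaDen (Z s) = X s * theta11 (Z s) ^ 2 ∧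
      thetaN (Z s) = Y s * theta11 (Z s) ^ 3 := by
  set p : ℝ → Prop := fun s => theta11 (Z s) ≠ 0 ∧ thetaDen (Z s) = X s * theta11 (Z s) ^ 2 ∧
      thetaN (Z s) = Y s * theta11 (Z s) ^ 3 with hp
  have hcS := differentiable_theta11.continuous
  have hcD := differentiable_thetaDen.continuous
  have hcN := differentiable_thetaN.continuous
  -- The set of parameters where the two curves agree is shown to be open and relatively closed in
  -- the connected interval.
  set A : Set ℝ := {s | s ∈ Set.Ioo (0 : ℝ) 1 ∧ p s} with hA
  have hopen : IsOpen A := by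
    rw [isOpen_iff_mem_nhds]
    rintro s₀ ⟨hs₀, hS, hD, hN⟩
    have hZc := (hZ s₀ hs₀).continuousAt
    have hIoo : ∀ᶠ s in 𝓝 s₀, s ∈ Set.Ioo (0 : ℝ) 1 := isOpen_Ioo.mem_nhds hs₀
    have hSe : ∀ᶠ s in 𝓝 s₀, theta11 (Z s) ≠ 0 :=
      (hcS.continuousAt.comp hZc).eventually_ne hS
    have hN0 : thetaN (Z s₀) ≠ 0 := by
      rw [hN]; exact mul_ne_zero (hY0 s₀ hs₀) (pow_ne_zero 3 hS)
    have hNe : ∀ᶠ s in 𝓝 s₀, thetaN (Z s) ≠ 0 :=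
      (hcN.continuousAt.comp hZc).eventually_ne hN0
    -- Both (X, Y) and the theta quotients along Z solve q' = g(s) V(q), since Z' = g/κ cancels κ. V
    -- is C¹, hence locally Lipschitz, and g is locally bounded.
    let V : ℂ × ℂ → ℂ × ℂ := fun q => (-q.2 / 3, -q.1 ^ 2 / 2)
    have hV : ContDiff ℝ 1 V := by fun_prop
    obtain ⟨K, W, hW, hLip⟩ := (hV.contDiffAt (x := (X s₀, Y s₀))).exists_lipschitzOnWith
    obtain ⟨G, hG⟩ : ∃ G : NNReal, ∀ᶠ s in 𝓝 s₀, ‖g s‖₊ ≤ G := by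
      have hgc := (hg.continuousAt (isOpen_Ioo.mem_nhds hs₀)).nnnorm
      refine ⟨‖g s₀‖₊ + 1, (hgc.eventually_lt_const (u := ‖g s₀‖₊ + 1) ?_).mono fun s hs => hs.le⟩
      exact lt_add_one _
    have heq : (fun s => (X s, Y s)) =ᶠ[𝓝 s₀]
        fun s => (thetaDen (Z s) / theta11 (Z s) ^ 2, thetaN (Z s) / theta11 (Z s) ^ 3) := by
      have hval : (thetaDen (Z s₀) / theta11 (Z s₀) ^ 2, thetaN (Z s₀) / theta11 (Z s₀) ^ 3) =
          (X s₀, Y s₀) := by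
        rw [hD, hN, mul_div_cancel_right₀ _ (pow_ne_zero 2 hS),
          mul_div_cancel_right₀ _ (pow_ne_zero 3 hS)]
      refine ODE_solution_unique_of_eventually (v := fun s q => g s • V q) (s := fun _ => W)
        (K := G * K) ?_ ?_ ?_ hval.symm
      · filter_upwards [hG] with s hs
        have h1 : LipschitzOnWith (‖g s‖₊ * K) (fun q => g s • V q) W := by
          intro a ha b hb
          rw [edist_smul₀, ENNReal.smul_def, smul_eq_mul]
          push_cast
          rw [mul_assoc]
          gcongr
          exact hLip ha hb
        exact h1.weaken (by gcongr)
      · have hc : ContinuousAt (fun s => (X s, Y s)) s₀ :=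
          (hX s₀ hs₀).continuousAt.prodMk (hY s₀ hs₀).continuousAt
        filter_upwards [hIoo, hc.eventually hW] with s hs hsW
        exact ⟨(hX s hs).prodMk (hY s hs), hsW⟩
      · have hc : ContinuousAt (fun s => (thetaDen (Z s) / theta11 (Z s) ^ 2,
            thetaN (Z s) / theta11 (Z s) ^ 3)) s₀ :=
          ((hcD.continuousAt.comp hZc).div ((hcS.continuousAt.comp hZc).pow 2)
            (pow_ne_zero 2 hS)).prodMk
          ((hcN.continuousAt.comp hZc).div ((hcS.continuousAt.comp hZc).pow 3)
            (pow_ne_zero 3 hS))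
        have hW' : W ∈ 𝓝 (thetaDen (Z s₀) / theta11 (Z s₀) ^ 2,
            thetaN (Z s₀) / theta11 (Z s₀) ^ 3) := by rw [hval]; exact hW
        filter_upwards [hIoo, hSe, hNe, hc.eventually hW'] with s hs h1 h2 hsW
        refine ⟨?_, hsW⟩
        have dX := (hasDerivAt_quotX hκ h1).comp_of_eq s (hZ s hs) rfl
        have dY := (hasDerivAt_quotY hκ h1 h2).comp_of_eq s (hZ s hs) rfl
        refine (dX.prodMk dY).congr_deriv ?_
        refine Prod.ext ?_ ?_
        · simp only [V, Prod.smul_fst, smul_eq_mul]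
          field_simp
        · simp only [V, Prod.smul_snd, smul_eq_mul]
          field_simp
    filter_upwards [hIoo, hSe, heq] with s hs h1 h2
    refine ⟨hs, h1, ?_, ?_⟩
    · have := (Prod.ext_iff.mp h2).1
      simp only at this
      rw [this]; field_simp
    · have := (Prod.ext_iff.mp h2).2
      simp only at this
      rw [this]; field_simp
  have hsub : Set.Ioo (0 : ℝ) 1 ⊆ A := by
    refine isPreconnected_Ioo.subset_of_closure_inter_subset hopen ?_ ?_
    · obtain ⟨s, hs, h⟩ := h0
      exact ⟨s, hs, hs, h⟩
    · rintro s ⟨hsc, hs⟩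
      have : (𝓝[A] s).NeBot := mem_closure_iff_nhdsWithin_neBot.mp hsc
      have hZc := (hZ s hs).continuousAt
      have tS := (hcS.continuousAt.comp hZc).mono_left (nhdsWithin_le_nhds (s := A))
      have tD := (hcD.continuousAt.comp hZc).mono_left (nhdsWithin_le_nhds (s := A))
      have tN := (hcN.continuousAt.comp hZc).mono_left (nhdsWithin_le_nhds (s := A))
      have tX := (hX s hs).continuousAt.mono_left (nhdsWithin_le_nhds (s := A))
      have tY := (hY s hs).continuousAt.mono_left (nhdsWithin_le_nhds (s := A))
      have hD : thetaDen (Z s) = X s * theta11 (Z s) ^ 2 :=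
        tendsto_nhds_unique_of_eventuallyEq tD (tX.mul (tS.pow 2)) (by
          filter_upwards [self_mem_nhdsWithin] with r hr
          exact hr.2.2.1)
      have hN : thetaN (Z s) = Y s * theta11 (Z s) ^ 3 :=
        tendsto_nhds_unique_of_eventuallyEq tN (tY.mul (tS.pow 3)) (by
          filter_upwards [self_mem_nhdsWithin] with r hr
          exact hr.2.2.2)
      -- The equations pass to the limit; if S vanished there, so would D, but D and S have no
      -- common zero.
      refine ⟨hs, fun h => ?_, hD, hN⟩
      exact thetaDen_ne_zero_of_theta11 h (by rw [hD, h]; ring)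
  exact fun s hs => (hsub hs).2

lemma Approaches.congr {α : Type} {l : Filter α} {T U T' U' : α → ℂ} (hT : T =ᶠ[l] T')
    (hU : U =ᶠ[l] U') {P : CZeta} (h : CZeta.Approaches l T U P) : CZeta.Approaches l T' U' P := by
  cases P with
  | finite t u ht hh => exact ⟨h.1.congr' hT, h.2.congr' hU⟩
  | zero v hh =>
    refine ⟨h.1.congr' hT, h.2.congr' ?_⟩
    filter_upwards [hT, hU] with a h1 h2
    rw [h1, h2]
  | infinity y hh =>
    refine ⟨h.1.congr' hT, h.2.congr' ?_⟩
    filter_upwards [hT, hU] with a h1 h2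
    rw [h1, h2]

/-- Implicit differentiation of the curve equation eliminates U'; the result is the system of
`lift_unique` with the integrand of ψ as g. -/
lemma hasDerivAt_coordX {T U : ℝ → ℂ} {T' U' : ℂ} {s : ℝ} (hT : HasDerivAt T T' s)
    (hU : HasDerivAt U U' s) (h : ∀ᶠ r in 𝓝 s, U r ^ 6 = T r ^ 3 * (T r - 1)) (hT0 : T s ≠ 0)
    (hT1 : T s - 1 ≠ 0) (hU0 : U s ≠ 0) :
    HasDerivAt (fun r => T r / U r ^ 2)
      (U s * T' / (T s * (T s - 1)) * (-(T s ^ 2 / U s ^ 3) / 3)) s ∧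
    HasDerivAt (fun r => T r ^ 2 / U r ^ 3)
      (U s * T' / (T s * (T s - 1)) * (-(T s / U s ^ 2) ^ 2 / 2)) s := by
  have h6 : U s ^ 6 = T s ^ 3 * (T s - 1) := h.self_of_nhds
  have hd : 6 * U s ^ 5 * U' = (4 * T s - 3) * T s ^ 2 * T' := by
    have e1 := hU.pow 6
    have e2 := (hT.pow 3).mul (hT.sub_const 1)
    have := (e1.congr_of_eventuallyEq (h.mono fun r hr => hr.symm)).unique e2
    norm_num at this
    rw [this]; ring
  have hU' : U' = (4 * T s - 3) * T s ^ 2 * T' / (6 * U s ^ 5) := by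
    field_simp; linear_combination hd
  constructor
  · refine (hT.div (hU.pow 2) (pow_ne_zero 2 hU0)).congr_deriv ?_
    rw [hU']
    norm_num
    field_simp
    linear_combination (T' * (24 * T s - 18)) * h6
  · refine ((hT.pow 2).div (hU.pow 3) (pow_ne_zero 3 hU0)).congr_deriv ?_
    rw [hU']
    norm_num
    field_simp
    linear_combination (T' * (24 * T s - 18)) * h6

/-- The integrand of the Abel-Jacobi integral along an arc. -/
def arcIntegrand (T U : ℝ → ℂ) (s : ℝ) : ℂ := U s * deriv T s / (T s * (T s - 1))

lemma continuousOn_arcIntegrand {P Q : CZeta} {T U : ℝ → ℂ} (h : CZeta.IsArc P Q T U) :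
    ContinuousOn (arcIntegrand T U) (Set.Ioo 0 1) := by
  have h1 := h.contDiffOn_t.continuousOn
  have h2 := h.contDiffOn_t.continuousOn_deriv_of_isOpen isOpen_Ioo le_rfl
  exact (h.contDiffOn_u.continuousOn.mul h2).div (h1.mul (h1.sub continuousOn_const))
    fun s hs => mul_ne_zero (h.t_ne_zero s hs) (sub_ne_zero.mpr (h.t_ne_one s hs))

/-- Arcs on the curve lift to the universal covering of the torus. -/
theorem exists_lift (hκ : IsWronskianConst κ) (hκ0 : κ ≠ 0) {P Q : CZeta} {T U : ℝ → ℂ} {w : ℂ}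
    (h : CZeta.IsArc P Q T U)
    (hw : Tendsto (fun p : ℝ × ℝ => ∫ s in p.1..p.2, arcIntegrand T U s)
        (𝓝[>] (0 : ℝ) ×ˢ 𝓝[<] (1 : ℝ)) (𝓝 w)) :
    ∃ (Z : ℝ → ℂ) (z₀ z₁ : ℂ), Tendsto Z (𝓝[>] 0) (𝓝 z₀) ∧ κ * (z₁ - z₀) = w ∧
      Param z₀ P ∧ Param z₁ Q ∧
      (∀ s ∈ Set.Ioo (0 : ℝ) 1, ∀ r ∈ Set.Ioo (0 : ℝ) 1,
        κ * (Z r - Z s) = ∫ x in s..r, arcIntegrand T U x) ∧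
      ∀ s ∈ Set.Ioo (0 : ℝ) 1, thetaDen (Z s) ≠ 0 := by
  have hg := continuousOn_arcIntegrand h
  have hhalf : (1 / 2 : ℝ) ∈ Set.Ioo (0 : ℝ) 1 := by norm_num
  have hU0 : ∀ s ∈ Set.Ioo (0 : ℝ) 1, U s ≠ 0 := fun s hs h0 => by
    have := h.curve s hs
    rw [h0, zero_pow (by norm_num)] at this
    exact mul_ne_zero (pow_ne_zero 3 (h.t_ne_zero s hs)) (sub_ne_zero.mpr (h.t_ne_one s hs)) this.symm
  have hint : ∀ s ∈ Set.Ioo (0 : ℝ) 1, ∀ r ∈ Set.Ioo (0 : ℝ) 1,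
      IntervalIntegrable (arcIntegrand T U) MeasureTheory.volume s r := fun s hs r hr =>
    (hg.mono (Set.ordConnected_Ioo.uIcc_subset hs hr)).intervalIntegrable
  set F : ℝ → ℂ := fun s => ∫ x in (1 / 2 : ℝ)..s, arcIntegrand T U x with hF
  have hFsub : ∀ s ∈ Set.Ioo (0 : ℝ) 1, ∀ r ∈ Set.Ioo (0 : ℝ) 1,
      F r - F s = ∫ x in s..r, arcIntegrand T U x := fun s hs r hr =>
    intervalIntegral.integral_interval_sub_left (hint _ hhalf _ hr) (hint _ hhalf _ hs)
  have hI0 : Set.Ioo (0 : ℝ) 1 ∈ 𝓝[>] (0 : ℝ) := Ioo_mem_nhdsGT one_pos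
  have hI1 : Set.Ioo (0 : ℝ) 1 ∈ 𝓝[<] (1 : ℝ) := Ioo_mem_nhdsLT one_pos
  obtain ⟨a, b, ha, hb, hab⟩ := exists_tendsto_of_tendsto_sub (F := F) (w := w)
    (hw.congr' (by
      filter_upwards [prod_mem_prod hI0 hI1] with p hp
      exact (hFsub _ hp.1 _ hp.2).symm))
  obtain ⟨z, hz⟩ := exists_param_eq (.finite (T (1 / 2)) (U (1 / 2)) (h.t_ne_zero _ hhalf)
    (h.curve _ hhalf))
  -- The lift starts from a parameter z of the midpoint of the arc and moves with velocity ψ/κ.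
  set Z : ℝ → ℂ := fun s => z + F s / κ with hZdef
  have hZ : ∀ s ∈ Set.Ioo (0 : ℝ) 1, HasDerivAt Z (arcIntegrand T U s / κ) s := fun s hs => by
    have hs' : Set.Ioo (0 : ℝ) 1 ∈ 𝓝 s := isOpen_Ioo.mem_nhds hs
    have := intervalIntegral.integral_hasDerivAt_right (hint _ hhalf _ hs)
      (hg.stronglyMeasurableAtFilter isOpen_Ioo s hs) (hg.continuousAt hs')
    exact (this.div_const κ).const_add z
  have hder : ∀ s ∈ Set.Ioo (0 : ℝ) 1, _ := fun s hs =>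
    hasDerivAt_coordX (T := T) (U := U) (s := s)
      ((h.contDiffOn_t.differentiableOn one_ne_zero).hasDerivAt (isOpen_Ioo.mem_nhds hs))
      ((h.contDiffOn_u.differentiableOn one_ne_zero).hasDerivAt (isOpen_Ioo.mem_nhds hs))
      (by filter_upwards [isOpen_Ioo.mem_nhds hs] with r hr using h.curve r hr)
      (h.t_ne_zero s hs) (sub_ne_zero.mpr (h.t_ne_one s hs)) (hU0 s hs)
  have key := lift_unique hκ hκ0 (X := fun r => T r / U r ^ 2) (Y := fun r => T r ^ 2 / U r ^ 3)
    hg (fun s hs => (hder s hs).1) (fun s hs => (hder s hs).2) hZ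
    (fun s hs => div_ne_zero (pow_ne_zero 2 (h.t_ne_zero s hs)) (pow_ne_zero 3 (hU0 s hs)))
    ⟨1 / 2, hhalf, (Param.finite_iff (ht := h.t_ne_zero _ hhalf)
      (h := h.curve _ hhalf) (hU0 _ hhalf)).mp (by simpa [hZdef, hF] using hz)⟩
  have hpar : ∀ s (hs : s ∈ Set.Ioo (0 : ℝ) 1),
      Param (Z s) (.finite (T s) (U s) (h.t_ne_zero s hs) (h.curve s hs)) := fun s hs =>
    (Param.finite_iff (hU0 s hs)).mpr (key s hs)
  have hreg : ∀ s ∈ Set.Ioo (0 : ℝ) 1, Z s ∈ regularSet := fun s hs => by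
    obtain ⟨h1, h2, h3⟩ := key s hs
    refine ⟨(hpar s hs).1, ?_, h1⟩
    rw [h3]
    exact mul_ne_zero (div_ne_zero (pow_ne_zero 2 (h.t_ne_zero s hs)) (pow_ne_zero 3 (hU0 s hs)))
      (pow_ne_zero 3 h1)
  have hT : ∀ s ∈ Set.Ioo (0 : ℝ) 1, quotT (Z s) = T s := fun s hs => by
    obtain ⟨h1, h2, h3⟩ := hpar s hs
    rw [quotT_eq, h2, mul_div_cancel_right₀ _ (pow_ne_zero 3 h1)]
  have hU : ∀ s ∈ Set.Ioo (0 : ℝ) 1, quotU (Z s) = U s := fun s hs => by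
    obtain ⟨h1, h2, h3⟩ := hpar s hs
    rw [quotU_eq, h3, mul_div_cancel_right₀ _ (pow_ne_zero 2 h1)]
  -- The limit of Z parametrizes some point R'. The arc tends to both R' and R, so these coincide,
  -- even at ramified end points.
  have hend : ∀ {l : Filter ℝ} [l.NeBot] {c : ℂ} {R : CZeta}, Set.Ioo (0 : ℝ) 1 ∈ l →
      Tendsto F l (𝓝 c) → CZeta.Approaches l T U R → Param (z + c / κ) R := by
    intro l _ c R hl hc hR
    obtain ⟨R', hR'⟩ := exists_param (z + c / κ)
    have h1 := hR'.approaches (l := l) (f := Z) ((hc.div_const κ).const_add z)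
      (by filter_upwards [hl] with s hs using hreg s hs)
    have h2 := Approaches.congr (by filter_upwards [hl] with s hs using hT s hs)
      (by filter_upwards [hl] with s hs using hU s hs) h1
    rwa [approaches_unique hR h2]
  refine ⟨Z, z + a / κ, z + b / κ, (ha.div_const κ).const_add z, ?_, hend hI0 ha h.source,
    hend hI1 hb h.target, fun s hs r hr => ?_, fun s hs => (hreg s hs).1⟩
  · rw [← hab]; field_simp; ring
  · rw [← hFsub s hs r hr, hZdef]; field_simp; ring

/-- The end point of a path is determined by the integral. -/
theorem HasIntegral.param (hκ : IsWronskianConst κ) (hκ0 : κ ≠ 0) {P Q : CZeta} {w : ℂ}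
    (h : CZeta.HasIntegral P Q w) {z : ℂ} (hz : Param z P) : Param (z + w / κ) Q := by
  induction h with
  | refl => simpa using hz
  | arc hPQ hQR hw ih =>
    obtain ⟨Z, z₀, z₁, -, h1, h2, h3, -⟩ := exists_lift hκ hκ0 hQR hw
    -- The lift of the last arc may start at another representative of the same lattice class.
    have h4 := ih.sub_mem h2
    rw [← param_add_mem h4] at h3
    convert h3 using 1
    rw [← h1]; field_simp; ring

end

/-! ### Paths on the curve from segments in ℂ -/

section
variable {κ : ℂ}

lemma quot_curve {z : ℂ} (h : thetaDen z ≠ 0) : quotU z ^ 6 = quotT z ^ 3 * (quotT z - 1) := by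
  rw [quotT_sub_one h, quotT_eq, quotU_eq]; field_simp

lemma quotT_ne_zero {z : ℂ} (h : z ∈ regularSet) : quotT z ≠ 0 := by
  rw [quotT_eq]; exact div_ne_zero (pow_ne_zero 2 h.2.1) (pow_ne_zero 3 h.1)

lemma quotU_ne_zero {z : ℂ} (h : z ∈ regularSet) : quotU z ≠ 0 := by
  rw [quotU_eq]; exact div_ne_zero (mul_ne_zero h.2.1 h.2.2) (pow_ne_zero 2 h.1)

lemma quotT_sub_one_ne_zero {z : ℂ} (h : z ∈ regularSet) : quotT z - 1 ≠ 0 := by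
  rw [quotT_sub_one h.1]; exact div_ne_zero (pow_ne_zero 6 h.2.2) (pow_ne_zero 3 h.1)

lemma differentiableOn_quotT : DifferentiableOn ℂ quotT regularSet := by
  rw [show quotT = _ from funext quotT_eq]
  exact (differentiable_thetaN.pow 2).differentiableOn.div
    (differentiable_thetaDen.pow 3).differentiableOn fun z hz => pow_ne_zero 3 hz.1

lemma differentiableOn_quotU : DifferentiableOn ℂ quotU regularSet := by
  rw [show quotU = _ from funext quotU_eq]
  exact (differentiable_thetaN.mul differentiable_theta11).differentiableOn.div
    (differentiable_thetaDen.pow 2).differentiableOn fun z hz => pow_ne_zero 2 hz.1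

/-- Straight segments in the torus give arcs on the curve. -/
lemma isArc_segment {z w : ℂ} {P Q : CZeta} (hz : Param z P) (hw : Param w Q)
    (hr : ∀ s ∈ Set.Ioo (0 : ℝ) 1, z + s * (w - z) ∈ regularSet) :
    CZeta.IsArc P Q (fun s => quotT (z + s * (w - z))) (fun s => quotU (z + s * (w - z))) := by
  have hγ : ContDiff ℝ 1 fun s : ℝ => z + s * (w - z) :=
    contDiff_const.add (ofRealCLM.contDiff.mul contDiff_const)
  have hc : ∀ s : ℝ, Tendsto (fun s : ℝ => z + s * (w - z)) (𝓝 s) (𝓝 (z + s * (w - z))) :=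
    fun s => hγ.continuous.tendsto s
  have hs : ∀ {f : ℂ → ℂ}, DifferentiableOn ℂ f regularSet →
      ContDiffOn ℝ 1 (fun s : ℝ => f (z + s * (w - z))) (Set.Ioo 0 1) := fun {f} hf =>
    ((hf.contDiffOn isOpen_regularSet).restrict_scalars ℝ).comp hγ.contDiffOn hr
  refine ⟨hs differentiableOn_quotT, hs differentiableOn_quotU, fun s hs => quot_curve (hr s hs).1,
    fun s hs => quotT_ne_zero (hr s hs), fun s hs => sub_ne_zero.mp (quotT_sub_one_ne_zero (hr s hs)),
    hz.approaches ?_ ?_, hw.approaches ?_ ?_⟩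
  · have := hc 0
    simp only [ofReal_zero, zero_mul, add_zero] at this
    exact this.mono_left nhdsWithin_le_nhds
  · filter_upwards [Ioo_mem_nhdsGT one_pos] with s hs using hr s hs
  · have := hc 1
    simp only [ofReal_one, one_mul, add_sub_cancel] at this
    exact this.mono_left nhdsWithin_le_nhds
  · filter_upwards [Ioo_mem_nhdsLT one_pos] with s hs using hr s hs

/-- Along a segment the integrand is the constant κ(w - z), because ψ pulls back to κ dz. -/
lemma hasIntegral_segment (hκ : IsWronskianConst κ) {z w a : ℂ} {O P Q : CZeta} (hz : Param z P)
    (hw : Param w Q) (hr : ∀ s ∈ Set.Ioo (0 : ℝ) 1, z + s * (w - z) ∈ regularSet)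
    (h : CZeta.HasIntegral O P a) : CZeta.HasIntegral O Q (a + κ * (w - z)) := by
  refine CZeta.HasIntegral.arc h (isArc_segment hz hw hr) ?_
  have hI : ∀ s ∈ Set.Ioo (0 : ℝ) 1, arcIntegrand (fun s => quotT (z + s * (w - z)))
      (fun s => quotU (z + s * (w - z))) s = κ * (w - z) := fun s hs => by
    have hγ : HasDerivAt (fun s : ℝ => z + s * (w - z)) (w - z) s := by
      simpa using ((hasDerivAt_id s).ofReal_comp.mul_const (w - z)).const_add z
    have hd := (hasDerivAt_quotT hκ (hr s hs)).comp_of_eq s hγ rfl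
    have h1 := quotT_ne_zero (hr s hs)
    have h2 := quotT_sub_one_ne_zero (hr s hs)
    have h3 := quotU_ne_zero (hr s hs)
    rw [arcIntegrand]
    have hd' : deriv (fun s : ℝ => quotT (z + s * (w - z))) s = _ := hd.deriv
    rw [hd']
    field_simp
  have hlim : Tendsto (fun p : ℝ × ℝ => (p.2 - p.1 : ℝ) • (κ * (w - z)))
      (𝓝[>] (0 : ℝ) ×ˢ 𝓝[<] (1 : ℝ)) (𝓝 ((1 - 0 : ℝ) • (κ * (w - z)))) := by
    have e1 : Tendsto (fun p : ℝ × ℝ => p.1) (𝓝[>] (0 : ℝ) ×ˢ 𝓝[<] (1 : ℝ)) (𝓝 0) :=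
      tendsto_fst.mono_right nhdsWithin_le_nhds
    have e2 : Tendsto (fun p : ℝ × ℝ => p.2) (𝓝[>] (0 : ℝ) ×ˢ 𝓝[<] (1 : ℝ)) (𝓝 1) :=
      tendsto_snd.mono_right nhdsWithin_le_nhds
    exact (e2.sub e1).smul_const _
  rw [sub_zero, one_smul] at hlim
  refine hlim.congr' ?_
  filter_upwards [prod_mem_prod (Ioo_mem_nhdsGT one_pos) (Ioo_mem_nhdsLT one_pos)] with p hp
  rw [← intervalIntegral.integral_const]
  refine intervalIntegral.integral_congr fun s hs => ?_
  exact (hI s (Set.ordConnected_Ioo.uIcc_subset hp.1 hp.2 hs)).symm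

/-- Every point is reached from the base point by a path with the expected integral. -/
theorem hasIntegral_of_param (hκ : IsWronskianConst κ) (z : ℂ) :
    ∀ P, Param z P → CZeta.HasIntegral CZeta.P₁ P (κ * z) := by
  set A : Set ℂ := {z | ∀ P, Param z P → CZeta.HasIntegral CZeta.P₁ P (κ * z)} with hA
  have hstep : ∀ {z w : ℂ}, (∀ s ∈ Set.Ioo (0 : ℝ) 1, z + s * (w - z) ∈ regularSet) →
      z ∈ A → w ∈ A := fun {z w} hr hz Q hQ => by
    obtain ⟨P, hP⟩ := exists_param z
    have := hasIntegral_segment hκ hP hQ hr (hz P hP)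
    rwa [show κ * z + κ * (w - z) = κ * w by ring] at this
  -- A punctured disc around z is regular, so the open segment between z and any w in it gives an
  -- arc even if z is not regular. Hence A is open and closed in ℂ.
  have hloc : ∀ z : ℂ, ∀ᶠ w in 𝓝 z, (w ∈ A ↔ z ∈ A) := fun z => by
    obtain ⟨ε, hε, hball⟩ := Metric.mem_nhdsWithin_iff.mp (regularSet_mem_nhdsNE z)
    filter_upwards [Metric.ball_mem_nhds z hε] with w hw
    by_cases hwz : w = z
    · rw [hwz]
    have hr : ∀ s ∈ Set.Ioo (0 : ℝ) 1, z + s * (w - z) ∈ regularSet := fun s hs => by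
      refine hball ⟨?_, ?_⟩
      · rw [Metric.mem_ball, dist_eq, add_sub_cancel_left, norm_mul, norm_real,
          Real.norm_of_nonneg hs.1.le]
        rw [Metric.mem_ball, dist_eq] at hw
        nlinarith [norm_nonneg (w - z), hs.2]
      · have h0 : (s : ℂ) ≠ 0 := by exact_mod_cast hs.1.ne'
        simpa [h0, sub_eq_zero] using hwz
    refine ⟨hstep fun s hs => ?_, hstep hr⟩
    have := hr (1 - s) ⟨by linarith [hs.2], by linarith [hs.1]⟩
    convert this using 1
    push_cast; ring
  have hclopen : IsClopen A := by
    constructor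
    · rw [← isOpen_compl_iff, isOpen_iff_mem_nhds]
      intro z hz
      filter_upwards [hloc z] with w hw
      exact fun h => hz (hw.mp h)
    · rw [isOpen_iff_mem_nhds]
      intro z hz
      filter_upwards [hloc z] with w hw
      exact hw.mpr hz
  have h0 : (0 : ℂ) ∈ A := fun P hP => by
    rw [hP.unique param_zero, mul_zero]
    exact CZeta.HasIntegral.refl _
  have := hclopen.eq_univ ⟨0, h0⟩
  have hz : z ∈ A := by rw [this]; trivial
  exact hz

/-! ### The automorphism of order six -/

lemma zeta6_pow_three : zeta6 ^ 3 = -1 := by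
  linear_combination (zeta6 + 1) * zeta6_sq

lemma zeta6_pow_six : zeta6 ^ 6 = 1 := by
  linear_combination (zeta6 ^ 3 - 1) * zeta6_pow_three

/-- The automorphism `(t, u) ↦ (t, ζ u)` of the curve. -/
def rotate : CZeta → CZeta
  | .finite t u ht h => .finite t (zeta6 * u) ht (by rw [mul_pow, zeta6_pow_six, h, one_mul])
  | .zero v h => .zero (zeta6 ^ 2 * v) (by rw [mul_pow, ← pow_mul, zeta6_pow_six, h, one_mul])
  | .infinity y h => .infinity (-y) (by rw [neg_sq, h])

lemma approaches_rotate {α : Type} {l : Filter α} {T U : α → ℂ} {P : CZeta}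
    (h : CZeta.Approaches l T U P) :
    CZeta.Approaches l T (fun s => zeta6 * U s) (rotate P) := by
  cases P with
  | finite t u ht hh => exact ⟨h.1, h.2.const_mul _⟩
  | zero v hh =>
    refine ⟨h.1, (h.2.const_mul (zeta6 ^ 2)).congr fun s => ?_⟩
    ring
  | infinity y hh =>
    refine ⟨h.1, h.2.neg.congr fun s => ?_⟩
    rw [mul_pow, zeta6_pow_three]; ring

/-- The form ψ is linear in u, so u ↦ ζu multiplies its integrals by ζ. -/
lemma hasIntegral_rotate {P Q : CZeta} {w : ℂ} (h : CZeta.HasIntegral P Q w) :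
    CZeta.HasIntegral (rotate P) (rotate Q) (zeta6 * w) := by
  induction h with
  | refl => rw [mul_zero]; exact CZeta.HasIntegral.refl _
  | arc hPQ hQR hw ih =>
    rw [mul_add]
    refine CZeta.HasIntegral.arc ih (⟨hQR.contDiffOn_t, contDiffOn_const.mul hQR.contDiffOn_u,
      fun s hs => ?_, hQR.t_ne_zero, hQR.t_ne_one, approaches_rotate hQR.source,
      approaches_rotate hQR.target⟩ : CZeta.IsArc _ _ _ _) ?_
    · rw [mul_pow, zeta6_pow_six, one_mul, hQR.curve s hs]
    · refine (hw.const_mul zeta6).congr fun p => ?_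
      rw [← intervalIntegral.integral_const_mul]
      refine intervalIntegral.integral_congr fun s _ => ?_
      ring

/-- The automorphism fixes P₁ and scales ψ by ζ, so in the parameter z it is complex multiplication
by ζ. -/
lemma param_rotate (hκ : IsWronskianConst κ) (hκ0 : κ ≠ 0) {z : ℂ} {P : CZeta} (h : Param z P) :
    Param (zeta6 * z) (rotate P) := by
  have h1 := hasIntegral_rotate (hasIntegral_of_param hκ z P h)
  have h2 : rotate CZeta.P₁ = CZeta.P₁ := by simp [CZeta.P₁, rotate]
  rw [h2] at h1
  have := HasIntegral.param hκ hκ0 h1 param_zero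
  convert this using 1
  field_simp; ring

lemma mem_latticeZeta_real_mul {r : ℝ} (h : (r : ℂ) * (1 + zeta6) ∈ latticeZeta) : ∃ n : ℤ, r = n := by
  obtain ⟨m, n, hmn⟩ := mem_latticeZeta.mp h
  have h3 : (0 : ℝ) < Real.sqrt 3 := by positivity
  have := congrArg Complex.im hmn
  simp [zeta6_im] at this
  exact ⟨m, this⟩

/-- The fixed points of the rotations are the points at infinity. -/
lemma thetaDen_fixed (hκ : IsWronskianConst κ) (hκ0 : κ ≠ 0) : thetaDen ((1 + zeta6) / 3) = 0 := by
  obtain ⟨P, hP⟩ := exists_param ((1 + zeta6) / 3)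
  have h1 := param_rotate hκ hκ0 (param_rotate hκ hκ0 hP)
  -- Multiplication by ζ² moves (1+ζ)/3 by a lattice vector, so two rotations fix P. A point with u
  -- ≠ 0 or above (0, 0) is not fixed, and P₁ is excluded because 1/3 is not an integer.
  have h2 : zeta6 * (zeta6 * ((1 + zeta6) / 3)) = (1 + zeta6) / 3 + -1 := by
    linear_combination (2 / 3 : ℂ) * zeta6_sq + zeta6 / 3 * zeta6_sq
  rw [h2, param_add_mem (neg_mem one_mem_latticeZeta)] at h1
  have h3 := hP.unique h1
  cases P with
  | finite t u ht h =>
    simp only [rotate, CZeta.finite.injEq, true_and] at h3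
    have hu : u = 0 := by
      have : (zeta6 - 2) * u = 0 := by linear_combination -h3 - u * zeta6_sq
      rcases mul_eq_zero.mp this with h4 | h4
      · have := congrArg Complex.re h4
        simp [zeta6_re] at this
        norm_num at this
      · exact h4
    obtain ⟨e1, e2, e3⟩ := hP
    rw [hu, zero_mul] at e3
    have hN : thetaN ((1 + zeta6) / 3) ≠ 0 := fun h0 => by
      rw [h0] at e2
      exact mul_ne_zero ht (pow_ne_zero 3 e1) (by rw [← e2]; ring)
    have hS := theta11_eq_zero.mp ((mul_eq_zero.mp e3).resolve_left hN)
    obtain ⟨n, hn⟩ := mem_latticeZeta_real_mul (r := 1 / 3) (by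
      convert hS using 1; push_cast; ring)
    have : (1 : ℝ) = 3 * n := by linarith
    have : (1 : ℤ) = 3 * n := by exact_mod_cast this
    omega
  | zero v h =>
    simp only [rotate, CZeta.zero.injEq] at h3
    have : (zeta6 + 1) * v = 0 := by
      linear_combination h3 + (zeta6 ^ 2 + zeta6) * v * zeta6_sq
    rcases mul_eq_zero.mp this with h4 | h4
    · have := congrArg Complex.re h4
      simp [zeta6_re] at this
      norm_num at this
    · rw [h4] at h; norm_num at h
  | infinity y h => exact hP.1

lemma thetaDen_add_mem {l : ℂ} (hl : l ∈ latticeZeta) (z : ℂ) :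
    thetaDen (z + l) = 0 ↔ thetaDen z = 0 :=
  latticeZeta_induction (p := fun z => thetaDen z = 0) (fun z => by rw [thetaDen_add_one])
    (fun z => by rw [thetaDen_add_zeta]; simp [thetaMult_ne_zero]) hl z

/-! ### A real arc from P₁ to infinity -/

/-- The coordinate `t` of the real arc from `P₁` to a point at infinity. -/
def realArcT (s : ℝ) : ℝ := (1 - s)⁻¹

/-- The coordinate `u` of the real arc from `P₁` to a point at infinity. -/
def realArcU (s : ℝ) : ℝ := s ^ (1 / 6 : ℝ) * (1 - s) ^ (-2 / 3 : ℝ)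

lemma realArc_rpow {s : ℝ} (hs : s ∈ Set.Ioo (0 : ℝ) 1) (k : ℕ) :
    realArcU s ^ k = s ^ (k / 6 : ℝ) * (1 - s) ^ (-2 * k / 3 : ℝ) := by
  have h1 : 0 < 1 - s := by linarith [hs.2]
  rw [realArcU, mul_pow, ← Real.rpow_natCast, ← Real.rpow_natCast, ← Real.rpow_mul hs.1.le,
    ← Real.rpow_mul h1.le]
  congr 2 <;> ring

/-- With t = 1/(1-s), the curve equation reads u⁶ = s/(1-s)⁴, and u is its positive root. Then
u³/(t(t-1)) = s^(-1/2), which tends to 1 and selects the point at infinity. -/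
lemma isArc_real : CZeta.IsArc CZeta.P₁ (.infinity 1 (by norm_num)) (fun s => (realArcT s : ℂ))
    (fun s => (realArcU s : ℂ)) := by
  have hne : ∀ s ∈ Set.Ioo (0 : ℝ) 1, 1 - s ≠ 0 := fun s hs => by linarith [hs.2]
  refine ⟨?_, ?_, fun s hs => ?_, fun s hs => ?_, fun s hs => ?_, ⟨?_, ?_⟩, ⟨?_, ?_⟩⟩
  · refine ofRealCLM.contDiff.comp_contDiffOn ?_
    exact (contDiffOn_const.sub contDiffOn_id).inv hne
  · refine ofRealCLM.contDiff.comp_contDiffOn ?_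
    exact (contDiffOn_id.rpow_const_of_ne fun s hs => hs.1.ne').mul
      ((contDiffOn_const.sub contDiffOn_id).rpow_const_of_ne hne)
  · have h1 : 0 < 1 - s := by linarith [hs.2]
    have := realArc_rpow hs 6
    norm_num at this
    have h2 : realArcU s ^ 6 = realArcT s ^ 3 * (realArcT s - 1) := by
      rw [this, realArcT]; field_simp; ring
    exact_mod_cast congrArg (fun x : ℝ => (x : ℂ)) h2
  · have := inv_ne_zero (hne s hs)
    simpa [realArcT] using fun h => hne s hs (by exact_mod_cast h)
  · intro h
    have h1 : realArcT s = 1 := by exact_mod_cast h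
    rw [realArcT, inv_eq_one] at h1
    linarith [hs.1]
  · have : ContinuousAt realArcT 0 := by unfold realArcT; fun_prop (disch := norm_num)
    have h1 := this.tendsto.mono_left (nhdsWithin_le_nhds (s := Set.Ioi (0 : ℝ)))
    have h2 := (continuous_ofReal.tendsto _).comp h1
    simpa [realArcT, Function.comp_def] using h2
  · have h1 : ContinuousAt realArcU 0 :=
      (Real.continuousAt_rpow_const _ _ (Or.inr (by norm_num))).mul
        ((continuousAt_const.sub continuousAt_id).rpow_const (Or.inl (by norm_num)))
    have h2 := (continuous_ofReal.tendsto _).comp (h1.tendsto.mono_left (nhdsWithin_le_nhds (s := Set.Ioi (0 : ℝ))))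
    have h3 : realArcU 0 = 0 := by rw [realArcU, Real.zero_rpow (by norm_num), zero_mul]
    rw [h3, ofReal_zero] at h2
    exact h2
  · rw [← tendsto_norm_atTop_iff_cobounded]
    have h1 : Tendsto (fun s : ℝ => 1 - s) (𝓝[<] 1) (𝓝[>] 0) := by
      refine tendsto_nhdsWithin_iff.mpr ⟨?_, ?_⟩
      · have : Tendsto (fun s : ℝ => 1 - s) (𝓝 1) (𝓝 (1 - 1)) := by
          exact (continuous_const.sub continuous_id).tendsto 1
        rw [sub_self] at this
        exact this.mono_left nhdsWithin_le_nhds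
      · filter_upwards [self_mem_nhdsWithin] with s hs
        exact sub_pos.mpr (Set.mem_Iio.mp hs)
    refine (tendsto_inv_nhdsGT_zero.comp h1).congr' ?_
    filter_upwards [self_mem_nhdsWithin] with s hs
    have h2 : 0 < 1 - s := sub_pos.mpr (Set.mem_Iio.mp hs)
    rw [norm_real, realArcT, Real.norm_of_nonneg (by positivity)]
    rfl
  · have h1 : Tendsto (fun s : ℝ => s ^ (-1 / 2 : ℝ)) (𝓝[<] 1) (𝓝 (1 ^ (-1 / 2 : ℝ))) :=
      (Real.continuousAt_rpow_const _ _ (Or.inl one_ne_zero)).tendsto.mono_left nhdsWithin_le_nhds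
    have h2 := (continuous_ofReal.tendsto _).comp h1
    rw [Real.one_rpow, ofReal_one] at h2
    refine h2.congr' ?_
    filter_upwards [Ioo_mem_nhdsLT one_pos] with s hs
    have h3 : 0 < 1 - s := by linarith [hs.2]
    have h4 := realArc_rpow hs 3
    norm_num at h4
    have h5 : s ^ (-1 / 2 : ℝ) = realArcU s ^ 3 / (realArcT s * (realArcT s - 1)) := by
      rw [h4, realArcT, show (-1 / 2 : ℝ) = 1 / 2 - 1 by norm_num, Real.rpow_sub_one hs.1.ne']
      have := hs.1.ne'
      have e : (1 - s)⁻¹ * ((1 - s)⁻¹ - 1) = s / (1 - s) ^ 2 := by field_simp; ring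
      rw [e]
      field_simp
    simp only [Function.comp_apply]
    rw [h5]; push_cast; rfl

/-- The integrand of the real arc is the integrand of the beta integral. -/
lemma arcIntegrand_real {s : ℝ} (hs : s ∈ Set.Ioo (0 : ℝ) 1) :
    arcIntegrand (fun s => (realArcT s : ℂ)) (fun s => (realArcU s : ℂ)) s =
      ((s ^ (-5 / 6 : ℝ) * (1 - s) ^ (-2 / 3 : ℝ) : ℝ) : ℂ) := by
  have h1 : (1 - s) ≠ 0 := by linarith [hs.2]
  have h0 := hs.1.ne'
  have hd : HasDerivAt realArcT ((1 - s) ^ 2)⁻¹ s := by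
    have := ((hasDerivAt_id s).const_sub 1).inv h1
    refine this.congr_deriv ?_
    simp
  rw [arcIntegrand, hd.ofReal_comp.deriv]
  have : s ^ (-5 / 6 : ℝ) * (1 - s) ^ (-2 / 3 : ℝ) =
      realArcU s * ((1 - s) ^ 2)⁻¹ / (realArcT s * (realArcT s - 1)) := by
    rw [realArcU, realArcT, show (-5 / 6 : ℝ) = 1 / 6 - 1 by norm_num, Real.rpow_sub_one h0]
    have e : (1 - s)⁻¹ * ((1 - s)⁻¹ - 1) = s / (1 - s) ^ 2 := by field_simp; ring
    rw [e]
    field_simp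
  rw [this]; push_cast; rfl

/-- Shows that 1 + ζ has argument π/6, opposite to that of κ, so that κ(1+ζ) is positive. -/
lemma root48_pow_4 : (Real.sqrt 3 : ℂ) * root48 ^ 4 = 1 + zeta6 := by
  have h : root48 ^ 4 = cexp ((Real.pi / 6 : ℝ) * I) := by
    rw [root48, ← Complex.exp_nat_mul]; congr 1; push_cast; ring
  rw [h, exp_mul_I, ← ofReal_cos, ← ofReal_sin, Real.cos_pi_div_six, Real.sin_pi_div_six, zeta6]
  push_cast
  linear_combination (1 / 2 : ℂ) * sqrt_three_sq

end

/-! ### The normalizing constant as a beta integral -/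

/-- The primitive of the beta integrand. -/
def betaPrimitive (s : ℝ) : ℝ := ∫ x in (0 : ℝ)..s, x ^ (-5 / 6 : ℝ) * (1 - x) ^ (-2 / 3 : ℝ)

lemma ofReal_betaIntegrand {x : ℝ} (hx : x ∈ Set.Icc (0 : ℝ) 1) :
    ((x ^ (-5 / 6 : ℝ) * (1 - x) ^ (-2 / 3 : ℝ) : ℝ) : ℂ) =
      (x : ℂ) ^ ((1 / 6 : ℂ) - 1) * (1 - (x : ℂ)) ^ ((1 / 3 : ℂ) - 1) := by
  rw [ofReal_mul, ofReal_cpow hx.1, ofReal_cpow (sub_nonneg.mpr hx.2)]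
  push_cast
  congr 2 <;> norm_num

lemma intervalIntegrable_betaIntegrand :
    IntervalIntegrable (fun x : ℝ => x ^ (-5 / 6 : ℝ) * (1 - x) ^ (-2 / 3 : ℝ))
      MeasureTheory.volume 0 1 := by
  have h := betaIntegral_convergent (u := 1 / 6) (v := 1 / 3) (by norm_num) (by norm_num)
  rw [intervalIntegrable_iff_integrableOn_Ioc_of_le zero_le_one] at h ⊢
  have h2 := h.re
  refine MeasureTheory.IntegrableOn.congr_fun h2 (fun x hx => ?_) measurableSet_Ioc
  rw [← ofReal_betaIntegrand ⟨hx.1.le, hx.2⟩]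
  rfl

lemma betaPrimitive_one : ((betaPrimitive 1 : ℝ) : ℂ) = betaIntegral (1 / 3) (1 / 6) := by
  rw [betaIntegral_symm, betaIntegral, betaPrimitive, ← intervalIntegral.integral_ofReal]
  refine intervalIntegral.integral_congr fun x hx => ?_
  rw [Set.uIcc_of_le zero_le_one] at hx
  exact ofReal_betaIntegrand hx

lemma continuousOn_betaPrimitive : ContinuousOn betaPrimitive (Set.Icc 0 1) := by
  have h := intervalIntegrable_betaIntegrand
  rw [intervalIntegrable_iff_integrableOn_Icc_of_le zero_le_one] at h
  have := intervalIntegral.continuousOn_primitive_interval (a := (0 : ℝ)) (b := 1)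
    (by rwa [Set.uIcc_of_le zero_le_one])
  rwa [Set.uIcc_of_le zero_le_one] at this

lemma betaPrimitive_zero : betaPrimitive 0 = 0 := by simp [betaPrimitive]

lemma betaPrimitive_one_nonneg : 0 ≤ betaPrimitive 1 := by
  refine intervalIntegral.integral_nonneg zero_le_one fun x hx => ?_
  exact mul_nonneg (Real.rpow_nonneg hx.1 _) (Real.rpow_nonneg (sub_nonneg.mpr hx.2) _)

lemma integral_arcIntegrand_real {s r : ℝ} (hs : s ∈ Set.Ioo (0 : ℝ) 1) (hr : r ∈ Set.Ioo (0 : ℝ) 1) :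
    ∫ x in s..r, arcIntegrand (fun s => (realArcT s : ℂ)) (fun s => (realArcU s : ℂ)) x =
      ((betaPrimitive r - betaPrimitive s : ℝ) : ℂ) := by
  have hint : ∀ t ∈ Set.Ioo (0 : ℝ) 1, IntervalIntegrable
      (fun x : ℝ => x ^ (-5 / 6 : ℝ) * (1 - x) ^ (-2 / 3 : ℝ)) MeasureTheory.volume 0 t :=
    fun t ht => intervalIntegrable_betaIntegrand.mono_set (by
      rw [Set.uIcc_of_le zero_le_one, Set.uIcc_of_le ht.1.le]
      exact Set.Icc_subset_Icc_right ht.2.le)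
  rw [betaPrimitive, betaPrimitive, intervalIntegral.integral_interval_sub_left (hint r hr) (hint s hs),
    ← intervalIntegral.integral_ofReal]
  refine intervalIntegral.integral_congr fun x hx => ?_
  exact arcIntegrand_real (Set.ordConnected_Ioo.uIcc_subset hs hr hx)

/-- The constant of the Wronskian relation is the normalizing constant of the integrals. -/
theorem isWronskianConst_period : IsWronskianConst CZeta.period ∧ CZeta.period ≠ 0 := by
  obtain ⟨c, hc, hκ'⟩ := exists_wronskian_const
  set κ : ℂ := c * (root48 ^ 4)⁻¹ with hκdef
  have hκ : IsWronskianConst κ := hκ'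
  have hc' : (c : ℂ) ≠ 0 := by exact_mod_cast hc.ne'
  have hκ0 : κ ≠ 0 := mul_ne_zero hc' (inv_ne_zero (pow_ne_zero 4 root48_ne_zero))
  set β : ℝ := betaPrimitive 1 with hβ
  have hIcc : ∀ᶠ s in 𝓝[>] (0 : ℝ), s ∈ Set.Ioo (0 : ℝ) 1 := Ioo_mem_nhdsGT one_pos
  have hb0 : Tendsto betaPrimitive (𝓝[>] 0) (𝓝 0) := by
    have := continuousOn_betaPrimitive 0 ⟨le_rfl, zero_le_one⟩
    rw [ContinuousWithinAt, betaPrimitive_zero] at this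
    refine this.mono_left ?_
    rw [← nhdsWithin_Ioo_eq_nhdsGT (zero_lt_one' ℝ)]
    exact nhdsWithin_mono _ Set.Ioo_subset_Icc_self
  have hb1 : Tendsto betaPrimitive (𝓝[<] 1) (𝓝 β) := by
    have := continuousOn_betaPrimitive 1 ⟨zero_le_one, le_rfl⟩
    refine Tendsto.mono_left this ?_
    rw [← nhdsWithin_Ioo_eq_nhdsLT (zero_lt_one' ℝ)]
    exact nhdsWithin_mono _ Set.Ioo_subset_Icc_self
  have hlim : Tendsto (fun p : ℝ × ℝ => ∫ s in p.1..p.2,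
      arcIntegrand (fun s => (realArcT s : ℂ)) (fun s => (realArcU s : ℂ)) s)
      (𝓝[>] (0 : ℝ) ×ˢ 𝓝[<] (1 : ℝ)) (𝓝 (β : ℂ)) := by
    have h1 := (continuous_ofReal.tendsto _).comp ((hb1.comp tendsto_snd).sub (hb0.comp tendsto_fst))
    rw [sub_zero] at h1
    refine h1.congr' ?_
    filter_upwards [prod_mem_prod (Ioo_mem_nhdsGT one_pos) (Ioo_mem_nhdsLT one_pos)] with p hp
    exact (integral_arcIntegrand_real hp.1 hp.2).symm
  obtain ⟨Z, z₀, z₁, hZ0, hw, hP, hQ, hZ, hD⟩ := exists_lift hκ hκ0 isArc_real hlim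
  have hz₀ : z₀ ∈ latticeZeta := by simpa using hP.sub_mem param_zero
  have hZs : ∀ s ∈ Set.Ioo (0 : ℝ) 1, κ * (Z s - z₀) = betaPrimitive s := fun s hs => by
    have h1 : Tendsto (fun r => κ * (Z s - Z r)) (𝓝[>] 0) (𝓝 (κ * (Z s - z₀))) :=
      (hZ0.const_sub (Z s)).const_mul κ
    have h2 : Tendsto (fun r => ((betaPrimitive s - betaPrimitive r : ℝ) : ℂ)) (𝓝[>] 0)
        (𝓝 ((betaPrimitive s - 0 : ℝ) : ℂ)) :=
      (continuous_ofReal.tendsto _).comp (hb0.const_sub _)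
    rw [sub_zero] at h2
    refine tendsto_nhds_unique_of_eventuallyEq h1 h2 ?_
    filter_upwards [hIcc] with r hr
    rw [hZ r hr s hs, integral_arcIntegrand_real hr hs]
  have hs3 : (0 : ℝ) < Real.sqrt 3 := by positivity
  have hκz : κ * (1 + zeta6) = (c * Real.sqrt 3 : ℝ) := by
    rw [← root48_pow_4, hκdef]
    have := root48_ne_zero
    push_cast; field_simp
  have h1ζ : (1 + zeta6 : ℂ) ≠ 0 := fun h => by
    rw [h, mul_zero] at hκz
    have : (0 : ℝ) = c * Real.sqrt 3 := by exact_mod_cast hκz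
    exact (mul_pos hc hs3).ne this
  -- The arc has real integrals, so its lift runs along the direction 1 + ζ and ends at ρ(1+ζ)
  -- modulo the lattice.
  set ρ : ℝ := β / (c * Real.sqrt 3) with hρ
  have hβρ : β = ρ * (c * Real.sqrt 3) := by rw [hρ]; field_simp
  have hray : ∀ {x : ℂ} {r : ℝ}, κ * x = (r * (c * Real.sqrt 3) : ℝ) → x = r * (1 + zeta6) :=
    fun {x r} h => by
      apply mul_left_cancel₀ hκ0
      rw [h, ofReal_mul, ← hκz]; ring
  have hQ' : Param (ρ * (1 + zeta6)) (.infinity 1 (by norm_num)) := by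
    rw [← param_add_mem hz₀]
    have : z₁ - z₀ = ρ * (1 + zeta6) := hray (by rw [hw, ← hβρ])
    rwa [← this, sub_add_cancel]
  have hρ0 : 0 < ρ := by
    refine lt_of_le_of_ne (div_nonneg betaPrimitive_one_nonneg (mul_pos hc hs3).le) fun h => ?_
    rw [← h, ofReal_zero, zero_mul] at hQ'
    exact thetaDen_zero_ne_zero hQ'.1
  have hfix := thetaDen_fixed hκ hκ0
  -- If ρ > 1/3, the lift would pass through (1+ζ)/3 at an interior parameter, where D vanishes
  -- although the arc is still at finite distance.
  have hρle : ρ ≤ 1 / 3 := by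
    by_contra! hlt
    have hmem : (1 / 3) * (c * Real.sqrt 3) ∈ Set.Ioo (betaPrimitive 0) (betaPrimitive 1) := by
      rw [betaPrimitive_zero, ← hβ, hβρ]
      exact ⟨by positivity, mul_lt_mul_of_pos_right hlt (mul_pos hc hs3)⟩
    obtain ⟨s, hs, hsv⟩ := intermediate_value_Ioo zero_le_one continuousOn_betaPrimitive hmem
    have h1 : Z s - z₀ = ((1 / 3 : ℝ) : ℂ) * (1 + zeta6) := hray (by rw [hZs s hs, hsv])
    refine hD s hs ?_
    rw [show Z s = (1 + zeta6) / 3 + z₀ by push_cast at h1; linear_combination h1]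
    exact (thetaDen_add_mem hz₀ _).mpr hfix
  -- The parameter (1+ζ)/3 belongs to y = 1 or y = -1; in the latter case its negative belongs to y
  -- = 1, because N/S³ is odd.
  have hmem : ∃ ε : ℝ, (ε = 1 ∨ ε = -1) ∧ ∃ n : ℤ, ρ - ε / 3 = n := by
    obtain ⟨P, hP'⟩ := exists_param ((1 + zeta6) / 3)
    cases P with
    | finite t u ht h => exact absurd hfix hP'.1
    | zero v h => exact absurd hfix hP'.1
    | infinity y h =>
      rcases sq_eq_sq_iff_eq_or_eq_neg.mp (h.trans (one_pow 2).symm) with rfl | rfl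
      · refine ⟨1, Or.inl rfl, mem_latticeZeta_real_mul ?_⟩
        convert hQ'.sub_mem hP' using 1
        push_cast; ring
      · have hneg : Param (-((1 + zeta6) / 3)) (.infinity 1 (by norm_num)) := by
          refine ⟨by rw [thetaDen_neg, hfix], ?_⟩
          rw [thetaN_neg, hP'.2, theta11_neg]; ring
        refine ⟨-1, Or.inr rfl, mem_latticeZeta_real_mul ?_⟩
        convert hQ'.sub_mem hneg using 1
        push_cast; ring
  -- From 0 < ρ ≤ 1/3 the integer ρ - ε/3 lies strictly between -1 and 1, hence is 0; ε = -1 would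
  -- make ρ negative.
  have hρ3 : ρ = 1 / 3 := by
    obtain ⟨ε, hε, n, hn⟩ := hmem
    have hn1 : n < 1 := by
      have : (n : ℝ) < 1 := by rw [← hn]; rcases hε with rfl | rfl <;> linarith
      exact_mod_cast this
    have hn2 : -1 < n := by
      have : (-1 : ℝ) < n := by rw [← hn]; rcases hε with rfl | rfl <;> linarith
      exact_mod_cast this
    have hn0 : n = 0 := by omega
    rw [hn0, Int.cast_zero] at hn
    rcases hε with rfl | rfl
    · linarith
    · linarith
  have hper : CZeta.period = κ := by
    apply mul_right_cancel₀ h1ζ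
    rw [CZeta.period, ← betaPrimitive_one, ← hβ, hκz, hβρ, hρ3]
    push_cast
    -- This is (1-ζ²)(1+ζ) = 3, a consequence of ζ² = ζ - 1.
    linear_combination (-(1 / 3) * (c * Real.sqrt 3) * (zeta6 + 2) : ℂ) * zeta6_sq
  rw [hper]
  exact ⟨hκ, hκ0⟩

/-! ### The Abel–Jacobi map and its inverse -/

theorem mainTheorem2 :
    -- the Abel-Jacobi map is defined by path integrals, independently of the path, and bijective
    (∀ P : CZeta, ∃ w : ℂ, CZeta.HasIntegral CZeta.P₁ P w) ∧
    (∀ (P : CZeta) (w : ℂ), CZeta.HasIntegral CZeta.P₁ P w →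
      CZeta.abelJacobi P = ((w / CZeta.period : ℂ) : EZeta)) ∧
    Function.Bijective CZeta.abelJacobi ∧
    -- its inverse is given by the theta quotients
    (∀ (z : ℂ) (P : CZeta), CZeta.abelJacobi P = (z : EZeta) →
      (thetaNumT z ≠ 0 ∨ thetaDen z ≠ 0) ∧
      (thetaNumU z ≠ 0 ∨ thetaDen z ≠ 0) ∧
      CZeta.coordT P = projQuot (thetaNumT z) (thetaDen z ^ 3) ∧
      CZeta.coordU P = projQuot (thetaNumU z) (thetaDen z ^ 2) ∧
      CZeta.Approaches (𝓝[≠] z) (fun w => thetaNumT w / thetaDen w ^ 3)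
        (fun w => thetaNumU w / thetaDen w ^ 2) P) := by
  obtain ⟨hκ, hκ0⟩ := isWronskianConst_period
  have hparam : ∀ {P : CZeta} {w : ℂ}, CZeta.HasIntegral CZeta.P₁ P w →
      Param (w / CZeta.period) P := fun {P w} h => by
    simpa using HasIntegral.param hκ hκ0 h param_zero
  have hex : ∀ P : CZeta, ∃ w : ℂ, CZeta.HasIntegral CZeta.P₁ P w := fun P => by
    obtain ⟨z, hz⟩ := exists_param_eq P
    exact ⟨_, hasIntegral_of_param hκ z P hz⟩
  have heq : ∀ {a b : ℂ}, a - b ∈ latticeZeta ↔ (a : EZeta) = (b : EZeta) := fun {a b} => by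
    rw [eq_comm, QuotientAddGroup.eq, neg_add_eq_sub]
  have hval : ∀ (P : CZeta) (w : ℂ), CZeta.HasIntegral CZeta.P₁ P w →
      CZeta.abelJacobi P = ((w / CZeta.period : ℂ) : EZeta) := fun P w h => by
    rw [CZeta.abelJacobi, dif_pos (hex P)]
    exact heq.mp ((hparam (hex P).choose_spec).sub_mem (hparam h))
  -- The parameter obtained from a path integral is a representative of the Abel–Jacobi image;
  -- `Param` does not depend on the representative.
  have hiff : ∀ {z : ℂ} {P : CZeta}, CZeta.abelJacobi P = (z : EZeta) → Param z P :=
    fun {z P} h => by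
      obtain ⟨w, hw⟩ := hex P
      rw [hval P w hw, ← heq] at h
      have := (param_add_mem h z P).mp (by rw [add_sub_cancel]; exact hparam hw)
      exact this
  refine ⟨hex, hval, ⟨fun P Q h => ?_, fun e => ?_⟩, fun z P h => ?_⟩
  · obtain ⟨w, hw⟩ := hex Q
    rw [hval Q w hw] at h
    exact (hiff h).unique (hparam hw)
  · obtain ⟨z, rfl⟩ := QuotientAddGroup.mk_surjective e
    obtain ⟨P, hP⟩ := exists_param z
    refine ⟨P, ?_⟩
    rw [hval P _ (hasIntegral_of_param hκ z P hP), mul_div_cancel_left₀ _ hκ0]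
  · have hP := hiff h
    obtain ⟨h1, h2, h3, h4⟩ := hP.coord
    exact ⟨h1, h2, h3, h4, hP.approaches_nhdsNE⟩

end
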